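/- Let $K$ be a field of characteristic zero. For $P,Q\in K[x,y]$ put $[P,Q]:=\partial_xP\,\partial_yQ-\partial_yP\,\partial_xQ$. The Jacobian conjecture (JC) in dimension two over $K$ says that whenever $P,Q\in K[x,y]$ satisfy $[P,Q]\in K^{\times}$, the $K$-algebra endomorphism of $K[x,y]$ given by $x\mapsto P$, $y\mapsto Q$ is an automorphism; a counterexample is a pair $(P,Q)$ with $[P,Q]\in K^{\times}$ for which it is not. Consider $K[x,y]$ as a subring of the ring $K[y]((x^{-1}))$ of formal Laurent series in $x^{-1}$ over $K[y]$. For $H=\sum a_{ij}x^iy^j\in K[y]((x^{-1}))$ let $\deg(H):=\sup\{i+j : a_{ij}\neq 0\}\in\mathbb{Z}\cup\{-\infty,+\infty\}$ be its total degree, and, for $H\ne 0$, let $H_+=h(y)x^k$ be its leading term for the $(1,0)$-grading, where $k$ is the largest exponent of $x$ that occurs in $H$ and $h\in K[y]\setminus\{0\}$ is the coefficient of $x^k$. **Theorem.** The JC in dimension two over $K$ is false if and only if there exist - $P,Q\in K[x,y]$ and $C,F\in K[y]((x^{-1}))$, - $n,m\in\mathbb{N}$ such that $n\nmid m$ and $m\nmid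 n$, - $\lambda_i\in K$ ($i=0,\dots,m+n-2$) with $\lambda_0=1$, such that - $C=x+C_{-1}x^{-1}+C_{-2}x^{-2}+\cdots$ with each $C_{-i}\in K[y]$ (in particular $C$ is invertible), - $\deg(C)=1$ and $\deg(F)=2-n$, - $F_+=x^{1-n}y$, - $C^n=P$ and $Q=\sum_{i=0}^{m+n-2}\lambda_iC^{m-i}+F$. Furthermore, under these conditions, $(P,Q)$ is a counterexample to the JC in dimension two over $K$. -/

import Mathlib

open MvPolynomial in
/-- The Jacobian `[P, Q] = ∂ₓP ∂ᵧQ - ∂ᵧP ∂ₓQ` of two polynomials in `K[x, y]`,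
where `x = X 0` and `y = X 1`. -/
noncomputable def jacobian {K : Type*} [Field K] (P Q : MvPolynomial (Fin 2) K) :
    MvPolynomial (Fin 2) K :=
  pderiv 0 P * pderiv 1 Q - pderiv 1 P * pderiv 0 Q

/-- `(P, Q)` is a Jacobian pair: `[P, Q]` is a nonzero constant. -/
def IsJacobianPair {K : Type*} [Field K] (P Q : MvPolynomial (Fin 2) K) : Prop :=
  ∃ c : K, c ≠ 0 ∧ jacobian P Q = MvPolynomial.C c

/-- `(P, Q)` defines an automorphism of `K[x, y]`: the `K`-algebra endomorphism with
`x ↦ P`, `y ↦ Q` is bijective. -/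
def DefinesAutomorphism {K : Type*} [Field K] (P Q : MvPolynomial (Fin 2) K) : Prop :=
  Function.Bijective
    (MvPolynomial.aeval ![P, Q] : MvPolynomial (Fin 2) K →ₐ[K] MvPolynomial (Fin 2) K)

/-- The Jacobian conjecture in dimension two over `K`. -/
def JacobianConjecture (K : Type*) [Field K] : Prop :=
  ∀ P Q : MvPolynomial (Fin 2) K, IsJacobianPair P Q → DefinesAutomorphism P Q

/-- `(P, Q)` is a counterexample to the Jacobian conjecture in dimension two over `K`. -/
def IsJacobianCounterexample {K : Type*} [Field K] (P Q : MvPolynomial (Fin 2) K) : Prop :=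
  IsJacobianPair P Q ∧ ¬ DefinesAutomorphism P Q

/-- The ring `K[y]((x⁻¹))`. It is the ring of Laurent series over `K[y]` in the variable
`t = x⁻¹`; so the coefficient of `x ^ k` is the one of `t ^ (-k)`. -/
abbrev XInvSeries (K : Type*) [Field K] : Type _ := LaurentSeries (Polynomial K)

namespace XInvSeries

variable {K : Type*} [Field K]

/-- The coefficient in `K[y]` of `x ^ k`. -/
def xCoeff (H : XInvSeries K) (k : ℤ) : Polynomial K := HahnSeries.coeff H (-k)

/-- The monomial `p(y) x ^ k`. -/
noncomputable def xMonomial (k : ℤ) (p : Polynomial K) : XInvSeries K :=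
  HahnSeries.single (-k) p

/-- The inclusion of `K` into `K[y]((x⁻¹))`. -/
noncomputable def const : K →+* XInvSeries K :=
  (HahnSeries.C : Polynomial K →+* HahnSeries ℤ (Polynomial K)).comp Polynomial.C

/-- The inclusion of `K[x, y]` into `K[y]((x⁻¹))`. -/
noncomputable def ofPoly : MvPolynomial (Fin 2) K →+* XInvSeries K :=
  MvPolynomial.eval₂Hom const ![xMonomial 1 1, xMonomial 0 Polynomial.X]

/-- The support: the set of `(i, j)` such that `x ^ i y ^ j` occurs in `H`. -/
def supp (H : XInvSeries K) : Set (ℤ × ℕ) := {p | (xCoeff H p.1).coeff p.2 ≠ 0}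

/-- The `w`-degree `sup {i w₁ + j w₂ | (i, j) ∈ supp H}`, in `ℤ ∪ {-∞, +∞}`
(in particular it is `-∞` for `H = 0`). -/
noncomputable def wdeg (w : ℤ × ℤ) (H : XInvSeries K) : WithBot (WithTop ℤ) :=
  sSup ((fun p : ℤ × ℕ => (((p.1 * w.1 + p.2 * w.2 : ℤ) : WithTop ℤ) : WithBot (WithTop ℤ))) ''
    supp H)

/-- The (total) degree: the `(1, 1)`-degree. -/
noncomputable def deg (H : XInvSeries K) : WithBot (WithTop ℤ) := wdeg (1, 1) H

/-- The leading term `H₊` for the `(1, 0)`-grading, that is, the part `h(y) x ^ k` of `H` with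
the largest `k` such that `h ≠ 0` (and `0` for `H = 0`). Note that `HahnSeries.order H`, the
least exponent of `x⁻¹` in `H`, is `-k`. -/
noncomputable def leadingTermX (H : XInvSeries K) : XInvSeries K :=
  xMonomial (-HahnSeries.order H) (xCoeff H (-HahnSeries.order H))

/-- The integer powers of an element, those with negative exponent being the powers of the
inverse; they have their usual meaning for an invertible element. -/
noncomputable def intPow (H : XInvSeries K) : ℤ → XInvSeries K
  | Int.ofNat k => H ^ k
  | Int.negSucc k => (Ring.inverse H) ^ (k + 1)

theorem intPow_unit (u : (XInvSeries K)ˣ) (k : ℤ) :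
    intPow (u : XInvSeries K) k = ((u ^ k : (XInvSeries K)ˣ) : XInvSeries K) := by
  cases k with
  | ofNat k => simp [intPow]
  | negSucc k => simp [intPow, zpow_negSucc]

/-- `C = x + C₋₁ x⁻¹ + C₋₂ x⁻² + ⋯` with all `C₋ᵢ` in `K[y]`. -/
def IsNormalized (C : XInvSeries K) : Prop :=
  xCoeff C 1 = 1 ∧ xCoeff C 0 = 0 ∧ ∀ k : ℤ, 1 < k → xCoeff C k = 0

/-- A series of the form `x + C₋₁ x⁻¹ + C₋₂ x⁻² + ⋯` is invertible, so that its integer powers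
are the usual ones. -/
theorem IsNormalized.isUnit {C : XInvSeries K} (hC : IsNormalized C) : IsUnit C := by
  obtain ⟨h1, -, h2⟩ := hC
  have hne : C.coeff (-1) ≠ 0 := by
    have h : C.coeff (-1) = 1 := h1
    rw [h]; exact one_ne_zero
  have hC0 : C ≠ 0 := by
    rintro rfl
    exact hne rfl
  have ho : C.order = -1 := by
    apply le_antisymm (HahnSeries.order_le_of_coeff_ne_zero hne)
    by_contra hlt
    have h3 : C.coeff (-(-C.order)) = 0 := h2 (-C.order) (by omega)
    rw [neg_neg] at h3
    exact HahnSeries.coeff_order_eq_zero.not.mpr hC0 h3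
  refine HahnSeries.isUnit_iff.mpr ?_
  rw [HahnSeries.leadingCoeff_eq, ho]
  have h : C.coeff (-1) = 1 := h1
  rw [h]
  exact isUnit_one

end XInvSeries

/-! ### Coefficients in `x`, degree in `x` and total degree -/

namespace XInvSeries

variable {K : Type*} [Field K]

/-! From the expansion to a counterexample: the Jacobian bracket is a derivation in each argument,
so powers of `C` contribute nothing to `[C^n, Q]`, and `[P, Q] = [C^n, F]`. Its leading term in `x`
is `[x^n, x^(1-n) y] = n`, and since `[P, Q]` is a polynomial it has no negative powers of `x`;
hence it equals `n`.

That `(P, Q)` is not an automorphism is `evalAt_ne_X`, a direct argument that `x = G(P, Q)` is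
impossible. Give `u`, `v` the weights `n`, `m`, let `d` be the weight of `G(u, v)`, let `g(y)` be
its top weighted form at `u = 1`, `v = y`, and let `k` be the multiplicity of the root `1` of `g`.
Since `P` and `Q` begin with `x^n` and `x^m`, the `x`-degree of `(∂ᵥ^k G)(P, Q)` is exactly `d -
km`. But `[P, H(P, Q)] = H_v(P, Q) [P, Q]`, so each `∂ᵥ` raises the `x`-degree by at most `n - 1`,
starting from the degree `1` of `x`; thus `d ≤ 1 + k(m + n - 1)`. On the other side, with `p = n /
gcd(n, m)`, the exponents of `g` agree modulo `p`, which forces `pk ≤ deg g` and `d ≥ mpk`. If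
neither of `n`, `m` divides the other, these bounds leave only `k = 0` and `d = 1`, and `1` is not
of the form `ni + mj` with `n, m ≥ 2`.

From a counterexample to the expansion: take one with `deg P + deg Q` minimal, and make `P`, `Q`
monic in `x` of degrees `n = deg P`, `m = deg Q` by a generic shear and scaling. Then `P` has an
`n`-th root `C = x + ⋯` of total degree `1`. Subtract multiples of `C^m, C^(m-1), …` from `Q`: as
`[C, Q]` has low degree, each leading coefficient met has zero `y`-derivative and is a constant,
down to `x^(1-n)`, where a coefficient linear in `y` appears (`exists_expansion`). If `n ∣ m`,
subtracting the power `P^(m/n) = C^m` from `Q` lowers the degree, against minimality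
(`not_dvd_of_minimal`); the case `m ∣ n` is symmetric. Finally a translation of `x` removes the
`x^0` coefficient of `C`, and an affine change of `y` turns the leading term of `F` into `x^(1-n)
y`. -/

theorem ext_xCoeff {A B : XInvSeries K} (h : ∀ k, A.xCoeff k = B.xCoeff k) : A = B := by
  ext1
  funext g
  simpa [xCoeff] using h (-g)

@[simp] theorem xCoeff_zero (k : ℤ) : xCoeff (0 : XInvSeries K) k = 0 := rfl

@[simp] theorem xCoeff_add (A B : XInvSeries K) (k : ℤ) :
    xCoeff (A + B) k = xCoeff A k + xCoeff B k := rfl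

@[simp] theorem xCoeff_sub (A B : XInvSeries K) (k : ℤ) :
    xCoeff (A - B) k = xCoeff A k - xCoeff B k :=
  HahnSeries.coeff_sub

theorem xCoeff_xMonomial (a : ℤ) (p : Polynomial K) (k : ℤ) :
    xCoeff (xMonomial a p) k = if k = a then p else 0 := by
  simp [xCoeff, xMonomial, HahnSeries.coeff_single]

theorem const_eq_xMonomial (c : K) : const c = xMonomial 0 (Polynomial.C c) := rfl

theorem xCoeff_const_mul (c : K) (A : XInvSeries K) (k : ℤ) :
    xCoeff (const c * A) k = Polynomial.C c * xCoeff A k := by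
  simp only [xCoeff, const, RingHom.comp_apply, HahnSeries.C_apply]
  exact HahnSeries.coeff_single_zero_mul

theorem xCoeff_xMonomial_mul (a : ℤ) (p : Polynomial K) (A : XInvSeries K) (k : ℤ) :
    xCoeff (xMonomial a p * A) k = p * xCoeff A (k - a) := by
  simp only [xCoeff, xMonomial]
  rw [HahnSeries.coeff_single_mul]
  congr 2
  ring

theorem xMonomial_mul_xMonomial (a b : ℤ) (p q : Polynomial K) :
    xMonomial a p * xMonomial b q = xMonomial (a + b) (p * q) := by
  simp only [xMonomial, HahnSeries.single_mul_single, neg_add]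

/-- All exponents of `x` in `A` are at most `a`. -/
def XLE (a : ℤ) (A : XInvSeries K) : Prop := ∀ k, a < k → xCoeff A k = 0

/-- The total degree of `A` is at most `d`. -/
def TotLE (d : ℤ) (A : XInvSeries K) : Prop :=
  ∀ (k : ℤ) (j : ℕ), d < k + j → (xCoeff A k).coeff j = 0

section Filtrations

variable {a b d e : ℤ} {A B : XInvSeries K}

theorem XLE.mono (h : XLE a A) (hab : a ≤ b) : XLE b A := fun k hk => h k (by omega)

theorem TotLE.mono (h : TotLE a A) (hab : a ≤ b) : TotLE b A :=
  fun k j hk => h k j (by omega)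

theorem TotLE.xle (h : TotLE d A) : XLE d A := fun k hk => by
  ext j
  simpa using h k j (by omega)

theorem XLE.add (hA : XLE a A) (hB : XLE a B) : XLE a (A + B) := fun k hk => by
  simp [hA k hk, hB k hk]

theorem XLE.sub (hA : XLE a A) (hB : XLE a B) : XLE a (A - B) := fun k hk => by
  simp [hA k hk, hB k hk]

theorem XLE.sum {ι : Type*} {s : Finset ι} {f : ι → XInvSeries K}
    (h : ∀ i ∈ s, XLE a (f i)) : XLE a (∑ i ∈ s, f i) :=
  Finset.sum_induction _ (XLE a) (fun _ _ => XLE.add) (fun _ _ => rfl) h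

theorem TotLE.add (hA : TotLE a A) (hB : TotLE a B) : TotLE a (A + B) := fun k j hk => by
  simp [hA k j hk, hB k j hk]

theorem TotLE.sub (hA : TotLE a A) (hB : TotLE a B) : TotLE a (A - B) := fun k j hk => by
  simp [hA k j hk, hB k j hk]

theorem TotLE.sum {ι : Type*} {s : Finset ι} {f : ι → XInvSeries K}
    (h : ∀ i ∈ s, TotLE a (f i)) : TotLE a (∑ i ∈ s, f i) :=
  Finset.sum_induction _ (TotLE a) (fun _ _ => TotLE.add) (fun _ _ _ => by simp) h

theorem XLE.const (c : K) : XLE 0 (const c) := fun k hk => by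
  rw [const_eq_xMonomial, xCoeff_xMonomial, if_neg (by omega)]

theorem TotLE.const (c : K) : TotLE 0 (const c) := fun k j hk => by
  rw [const_eq_xMonomial, xCoeff_xMonomial]
  split_ifs
  · rw [Polynomial.coeff_C, if_neg (by omega)]
  · simp

theorem exists_xle (A : XInvSeries K) : ∃ a, XLE a A := by
  refine ⟨-A.order, fun k hk => ?_⟩
  exact HahnSeries.coeff_eq_zero_of_lt_order (by omega)

theorem XLE.mul (hA : XLE a A) (hB : XLE b B) : XLE (a + b) (A * B) := fun k hk => by
  rw [xCoeff, HahnSeries.coeff_mul]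
  refine Finset.sum_eq_zero fun ij hij => ?_
  obtain ⟨h1, h2, h3⟩ := Finset.mem_antidiagonal.mp hij
  by_cases h : a < -ij.1
  · have := hA _ h
    rw [xCoeff, neg_neg] at this
    rw [this, zero_mul]
  · have := hB (-ij.2) (by omega)
    rw [xCoeff, neg_neg] at this
    rw [this, mul_zero]

theorem XLE.xCoeff_mul (hA : XLE a A) (hB : XLE b B) :
    xCoeff (A * B) (a + b) = xCoeff A a * xCoeff B b := by
  rw [xCoeff, HahnSeries.coeff_mul, Finset.sum_eq_single (-a, -b)]
  · rfl
  · intro ij hij hne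
    obtain ⟨h1, h2, h3⟩ := Finset.mem_antidiagonal.mp hij
    by_cases h : a < -ij.1
    · have := hA _ h
      rw [xCoeff, neg_neg] at this
      rw [this, zero_mul]
    · have := hB (-ij.2) (by
        by_contra hc
        exact hne (Prod.ext (by simp only; omega) (by simp only; omega)))
      rw [xCoeff, neg_neg] at this
      rw [this, mul_zero]
  · intro h
    simp only [Finset.mem_antidiagonal, HahnSeries.mem_support, not_and_or, not_not] at h
    rcases h with h | h | h
    · simp only [h, zero_mul]
    · simp only [h, mul_zero]
    · exact absurd (neg_add a b).symm h

theorem TotLE.mul (hA : TotLE a A) (hB : TotLE b B) : TotLE (a + b) (A * B) := fun k l hk => by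
  rw [xCoeff, HahnSeries.coeff_mul, Polynomial.finsetSum_coeff]
  refine Finset.sum_eq_zero fun ij hij => ?_
  obtain ⟨h1, h2, h3⟩ := Finset.mem_antidiagonal.mp hij
  rw [Polynomial.coeff_mul]
  refine Finset.sum_eq_zero fun pq hpq => ?_
  have hpq' := Finset.HasAntidiagonal.mem_antidiagonal.mp hpq
  by_cases h : a < -ij.1 + pq.1
  · have := hA _ _ h
    rw [xCoeff, neg_neg] at this
    rw [this, zero_mul]
  · have := hB (-ij.2) pq.2 (by omega)
    rw [xCoeff, neg_neg] at this
    rw [this, mul_zero]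

theorem XLE.const_mul (c : K) (hA : XLE a A) : XLE a (XInvSeries.const c * A) := by
  simpa using (XLE.const c).mul hA

theorem TotLE.const_mul (c : K) (hA : TotLE a A) : TotLE a (XInvSeries.const c * A) := by
  simpa using (TotLE.const c).mul hA

/-- `A` has leading term `x ^ a` for the `(1, 0)`-grading. -/
def MonicX (a : ℤ) (A : XInvSeries K) : Prop := XLE a A ∧ xCoeff A a = 1

theorem MonicX.one : MonicX 0 (1 : XInvSeries K) := by
  have h : (1 : XInvSeries K) = XInvSeries.const 1 := (map_one _).symm
  refine ⟨h ▸ XLE.const 1, ?_⟩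
  rw [h, const_eq_xMonomial, xCoeff_xMonomial, if_pos rfl, map_one]

theorem TotLE.one : TotLE 0 (1 : XInvSeries K) := by
  rw [← map_one XInvSeries.const]
  exact TotLE.const 1

theorem MonicX.mul (hA : MonicX a A) (hB : MonicX b B) : MonicX (a + b) (A * B) :=
  ⟨hA.1.mul hB.1, by rw [hA.1.xCoeff_mul hB.1, hA.2, hB.2, mul_one]⟩

theorem MonicX.pow (hA : MonicX a A) (n : ℕ) : MonicX (n * a) (A ^ n) := by
  induction n with
  | zero => simpa using MonicX.one
  | succ n ih =>
    rw [pow_succ, show ((n + 1 : ℕ) : ℤ) * a = n * a + a by push_cast; ring]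
    exact ih.mul hA

theorem XLE.pow (hA : XLE a A) (n : ℕ) : XLE (n * a) (A ^ n) := by
  induction n with
  | zero => simpa using MonicX.one.1
  | succ n ih =>
    rw [pow_succ, show ((n + 1 : ℕ) : ℤ) * a = n * a + a by push_cast; ring]
    exact ih.mul hA

theorem XLE.xCoeff_pow (hA : XLE a A) (n : ℕ) : xCoeff (A ^ n) (n * a) = xCoeff A a ^ n := by
  induction n with
  | zero => simpa using MonicX.one.2
  | succ n ih =>
    rw [pow_succ, show ((n + 1 : ℕ) : ℤ) * a = n * a + a by push_cast; ring,
      (hA.pow n).xCoeff_mul hA, ih, pow_succ]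

theorem TotLE.pow (hA : TotLE a A) (n : ℕ) : TotLE (n * a) (A ^ n) := by
  induction n with
  | zero => simpa using TotLE.one
  | succ n ih =>
    rw [pow_succ, show ((n + 1 : ℕ) : ℤ) * a = n * a + a by push_cast; ring]
    exact ih.mul hA

/-- The exponents of `x` in a series are bounded above but not below, so its coefficients are
reached from the top downwards. -/
theorem descending_induction {p : ℤ → Prop} (a : ℤ) (h0 : ∀ k, a < k → p k)
    (h : ∀ k, k ≤ a → (∀ j, k < j → p j) → p k) (k : ℤ) : p k := by
  have key : ∀ N : ℕ, ∀ k, a - N < k → p k := by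
    intro N
    induction N with
    | zero => intro k hk; exact h0 k (by simpa using hk)
    | succ N ih =>
      intro k hk
      by_cases hk' : k ≤ a
      · exact h k hk' fun j hj => ih j (by push_cast at hk; omega)
      · exact h0 k (by omega)
  exact key (a - k + 1).toNat k (by omega)

/-- The part of `A` with exponents of `x` larger than `k`. -/
noncomputable def truncGT (k : ℤ) (A : XInvSeries K) : XInvSeries K := HahnSeries.truncLT (-k) A

theorem xCoeff_truncGT (k : ℤ) (A : XInvSeries K) (j : ℤ) :
    xCoeff (truncGT k A) j = if k < j then xCoeff A j else 0 := by
  simp [xCoeff, truncGT]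

theorem xle_sub_truncGT (k : ℤ) (A : XInvSeries K) : XLE k (A - truncGT k A) := fun j hj => by
  simp [xCoeff_truncGT, hj]

theorem xCoeff_sub_truncGT (k : ℤ) (A : XInvSeries K) :
    xCoeff (A - truncGT k A) k = xCoeff A k := by
  simp [xCoeff_truncGT]

theorem totLE_truncGT {k : ℤ} (h : ∀ i, k < i → ∀ j : ℕ, d < i + j → (xCoeff A i).coeff j = 0) :
    TotLE d (truncGT k A) := fun i j hij => by
  rw [xCoeff_truncGT]
  split_ifs with hk
  · exact h i hk j hij
  · simp

/-- Descending induction on the exponent `k`: the part `T` of `B` above `x^k` already has total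
degree at most `b`, hence so does `A * (B - T)` with bound `a + b`, and the top coefficient of the
latter is the coefficient of `x^k` in `B`. -/
theorem TotLE.of_mul_monic (hA : TotLE a A) (hA1 : xCoeff A a = 1) (h : TotLE (a + b) (A * B)) :
    TotLE b B := by
  obtain ⟨c, hc⟩ := exists_xle B
  refine descending_induction c (fun k hk j _ => by simp [hc k hk]) fun k _ ih j hj => ?_
  have h1 := (hA.mul (totLE_truncGT ih)) (a + k) j (by omega)
  have h2 := h (a + k) j (by omega)
  have h3 := hA.xle.xCoeff_mul (xle_sub_truncGT k B)
  rw [hA1, one_mul, xCoeff_sub_truncGT, mul_sub, xCoeff_sub] at h3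
  rw [← h3, Polynomial.coeff_sub, h1, h2, sub_zero]

theorem MonicX.of_mul (hA : MonicX a A) (h : MonicX (a + b) (A * B)) : MonicX b B := by
  have hB : XLE b B := by
    obtain ⟨c, hc⟩ := exists_xle B
    refine descending_induction c (fun k hk _ => hc k hk) fun k _ ih hk => ?_
    have hB' : XLE k B := fun j hj => ih j hj (by omega)
    have := hA.1.xCoeff_mul hB'
    rwa [hA.2, one_mul, h.1 _ (by omega), eq_comm] at this
  refine ⟨hB, ?_⟩
  have := hA.1.xCoeff_mul hB
  rwa [hA.2, one_mul, h.2, eq_comm] at this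

end Filtrations

section Units

variable {a : ℤ} {u : (XInvSeries K)ˣ}

theorem MonicX.zpow (h : MonicX a (u : XInvSeries K)) (k : ℤ) :
    MonicX (k * a) ((u ^ k : (XInvSeries K)ˣ) : XInvSeries K) := by
  have hinv : MonicX (-a) ((u⁻¹ : (XInvSeries K)ˣ) : XInvSeries K) := by
    refine h.of_mul ?_
    rw [Units.mul_inv, add_neg_cancel]
    exact MonicX.one
  cases k with
  | ofNat k => simpa using h.pow k
  | negSucc k =>
    rw [zpow_negSucc, ← inv_pow, Units.val_pow_eq_pow_val, Int.negSucc_eq, neg_mul_comm]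
    exact_mod_cast hinv.pow (k + 1)

theorem TotLE.zpow (h : TotLE a (u : XInvSeries K)) (h1 : xCoeff (u : XInvSeries K) a = 1)
    (k : ℤ) : TotLE (k * a) ((u ^ k : (XInvSeries K)ˣ) : XInvSeries K) := by
  have hinv : TotLE (-a) ((u⁻¹ : (XInvSeries K)ˣ) : XInvSeries K) := by
    refine h.of_mul_monic h1 ?_
    rw [Units.mul_inv, add_neg_cancel]
    exact TotLE.one
  cases k with
  | ofNat k => simpa using h.pow k
  | negSucc k =>
    rw [zpow_negSucc, ← inv_pow, Units.val_pow_eq_pow_val, Int.negSucc_eq, neg_mul_comm]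
    exact_mod_cast hinv.pow (k + 1)

end Units

end XInvSeries

/-! ### Derivations and the Jacobian bracket -/

namespace XInvSeries

variable {K : Type*} [Field K]

/-- The additive map that acts on `K[y] x ^ k` as `s d/dy + k c`. -/
noncomputable def coeffMap (s c : ℤ) : XInvSeries K →+ XInvSeries K where
  toFun A :=
    { coeff := fun g => s • Polynomial.derivative (A.coeff g) + (-g * c) • A.coeff g
      isPWO_support' := A.isPWO_support.mono fun g hg hg' => hg (by
        show s • Polynomial.derivative (A.coeff g) + (-g * c) • A.coeff g = 0
        rw [hg', map_zero, smul_zero, smul_zero, add_zero]) }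
  map_zero' := by ext1; funext g; simp
  map_add' A B := by
    ext1; funext g
    simp only [HahnSeries.coeff_add', Pi.add_apply, map_add, smul_add]
    abel

theorem coeff_coeffMap (s c : ℤ) (A : XInvSeries K) (g : ℤ) :
    (coeffMap s c A).coeff g =
      s • Polynomial.derivative (A.coeff g) + (-g * c) • A.coeff g := rfl

/-- The Leibniz rule. -/
def IsDeriv (d : XInvSeries K →+ XInvSeries K) : Prop :=
  ∀ A B, d (A * B) = A * d B + d A * B

theorem IsDeriv.one {d : XInvSeries K →+ XInvSeries K} (hd : IsDeriv d) : d 1 = 0 := by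
  simpa using hd 1 1

theorem IsDeriv.pow {d : XInvSeries K →+ XInvSeries K} (hd : IsDeriv d) (A : XInvSeries K)
    (n : ℕ) : d (A ^ n) = n * A ^ (n - 1) * d A := by
  induction n with
  | zero => simp [hd.one]
  | succ n ih =>
    rw [pow_succ, hd, ih]
    cases n with
    | zero => simp
    | succ n =>
      simp only [Nat.add_sub_cancel]
      push_cast
      ring

theorem isDeriv_coeffMap (s c : ℤ) : IsDeriv (coeffMap s c : XInvSeries K →+ XInvSeries K) := by
  intro A B
  -- The support may shrink under the derivation. Enlarging the index sets to the supports of `A`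
  -- and `B` lets all three products be summed over the same antidiagonal.
  have hsupp : ∀ A : XInvSeries K, (coeffMap s c A).support ⊆ A.support := fun A g hg hg' =>
    hg (by rw [coeff_coeffMap, hg', map_zero, smul_zero, smul_zero, add_zero])
  ext1
  funext g
  rw [HahnSeries.coeff_add, HahnSeries.coeff_mul_right' B.isPWO_support (hsupp B),
    HahnSeries.coeff_mul_left' A.isPWO_support (hsupp A), coeff_coeffMap, HahnSeries.coeff_mul,
    map_sum, Finset.smul_sum, Finset.smul_sum, ← Finset.sum_add_distrib, ← Finset.sum_add_distrib]
  refine Finset.sum_congr rfl fun ij hij => ?_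
  obtain ⟨-, -, h⟩ := Finset.mem_antidiagonal.mp hij
  rw [coeff_coeffMap, coeff_coeffMap, Polynomial.derivative_mul, ← h]
  simp only [zsmul_eq_mul]
  push_cast
  ring

/-- The Euler derivation `x ∂ₓ`. -/
noncomputable def eulerX : XInvSeries K →+ XInvSeries K := coeffMap 0 1

/-- The derivation `∂ᵧ`. -/
noncomputable def derivY : XInvSeries K →+ XInvSeries K := coeffMap 1 0

theorem xCoeff_eulerX (A : XInvSeries K) (k : ℤ) : xCoeff (eulerX A) k = k • xCoeff A k := by
  rw [xCoeff, eulerX, coeff_coeffMap]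
  simp [xCoeff]

theorem xCoeff_derivY (A : XInvSeries K) (k : ℤ) :
    xCoeff (derivY A) k = Polynomial.derivative (xCoeff A k) := by
  rw [xCoeff, derivY, coeff_coeffMap]
  simp [xCoeff]

theorem eulerX_const (c : K) : eulerX (const c) = 0 := ext_xCoeff fun k => by
  rw [xCoeff_eulerX, const_eq_xMonomial, xCoeff_xMonomial]
  split_ifs with h <;> simp [h]

theorem derivY_const (c : K) : derivY (const c) = 0 := ext_xCoeff fun k => by
  rw [xCoeff_derivY, const_eq_xMonomial, xCoeff_xMonomial]
  split_ifs with h <;> simp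

/-- The bracket `x [A, B]`, as an additive map of `B`. -/
noncomputable def bracket (A : XInvSeries K) : XInvSeries K →+ XInvSeries K :=
  (AddMonoidHom.mulLeft (eulerX A)).comp derivY - (AddMonoidHom.mulLeft (derivY A)).comp eulerX

theorem bracket_apply (A B : XInvSeries K) :
    bracket A B = eulerX A * derivY B - derivY A * eulerX B := rfl

theorem isDeriv_bracket (A : XInvSeries K) : IsDeriv (bracket A) := fun B C => by
  simp only [bracket_apply]
  rw [show derivY (B * C) = _ from isDeriv_coeffMap 1 0 B C,
    show eulerX (B * C) = _ from isDeriv_coeffMap 0 1 B C]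
  simp only [derivY, eulerX]
  ring

theorem bracket_swap (A B : XInvSeries K) : bracket A B = -bracket B A := by
  rw [bracket_apply, bracket_apply]
  ring

theorem bracket_self (A : XInvSeries K) : bracket A A = 0 := by
  rw [bracket_apply, mul_comm, sub_self]

theorem bracket_const (A : XInvSeries K) (c : K) : bracket A (const c) = 0 := by
  rw [bracket_apply, eulerX_const, derivY_const, mul_zero, mul_zero, sub_zero]

theorem bracket_const_mul (A B : XInvSeries K) (c : K) :
    bracket A (const c * B) = const c * bracket A B := by
  rw [isDeriv_bracket, bracket_const, zero_mul, add_zero]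

/-- A derivation killing `u` kills its powers, and also its inverse powers, by differentiating `u^k
u^(-k) = 1`. -/
theorem bracket_zpow (u : (XInvSeries K)ˣ) (k : ℤ) :
    bracket (u : XInvSeries K) ((u ^ k : (XInvSeries K)ˣ) : XInvSeries K) = 0 := by
  have hpow : ∀ n : ℕ, bracket (u : XInvSeries K) ((u : XInvSeries K) ^ n) = 0 := fun n => by
    rw [(isDeriv_bracket _).pow, bracket_self, mul_zero]
  cases k with
  | ofNat k => simpa using hpow k
  | negSucc k =>
    have h := congrArg (bracket (u : XInvSeries K)) (Units.mul_inv (u ^ (k + 1)))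
    rw [(isDeriv_bracket _).one, isDeriv_bracket, Units.val_pow_eq_pow_val, hpow, zero_mul,
      add_zero, ← Units.val_pow_eq_pow_val, Units.mul_right_eq_zero] at h
    rwa [zpow_negSucc]

theorem bracket_pow_left (A B : XInvSeries K) (n : ℕ) :
    bracket (A ^ n) B = n * A ^ (n - 1) * bracket A B := by
  rw [bracket_swap, (isDeriv_bracket _).pow, bracket_swap A B]
  ring

section Filtrations

variable {a b d e : ℤ} {A B : XInvSeries K}

theorem XLE.eulerX (h : XLE a A) : XLE a (eulerX A) := fun k hk => by
  rw [xCoeff_eulerX, h k hk, smul_zero]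

theorem XLE.derivY (h : XLE a A) : XLE a (derivY A) := fun k hk => by
  rw [xCoeff_derivY, h k hk, map_zero]

theorem XLE.bracket (hA : XLE a A) (hB : XLE b B) : XLE (a + b) (bracket A B) :=
  (hA.eulerX.mul hB.derivY).sub (hA.derivY.mul hB.eulerX)

theorem XLE.xCoeff_bracket (hA : XLE a A) (hB : XLE b B) :
    xCoeff (XInvSeries.bracket A B) (a + b) =
      a • xCoeff A a * Polynomial.derivative (xCoeff B b) -
        Polynomial.derivative (xCoeff A a) * b • xCoeff B b := by
  rw [bracket_apply, xCoeff_sub, hA.eulerX.xCoeff_mul hB.derivY, hA.derivY.xCoeff_mul hB.eulerX,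
    xCoeff_eulerX, xCoeff_eulerX, xCoeff_derivY, xCoeff_derivY]

theorem MonicX.xCoeff_bracket (hA : MonicX a A) (hB : XLE b B) :
    xCoeff (XInvSeries.bracket A B) (a + b) = a • Polynomial.derivative (xCoeff B b) := by
  rw [hA.1.xCoeff_bracket hB, hA.2, Polynomial.derivative_one, zero_mul, sub_zero, smul_mul_assoc,
    one_mul]

theorem TotLE.eulerX (h : TotLE a A) : TotLE a (eulerX A) := fun k j hk => by
  rw [xCoeff_eulerX, Polynomial.coeff_smul, h k j hk, smul_zero]

theorem TotLE.derivY (h : TotLE a A) : TotLE (a - 1) (derivY A) := fun k j hk => by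
  rw [xCoeff_derivY, Polynomial.coeff_derivative, h k (j + 1) (by push_cast; omega), zero_mul]

/-- `x ∂ₓ` preserves the total degree and `∂ᵧ` lowers it by one. -/
theorem TotLE.bracket (hA : TotLE a A) (hB : TotLE b B) : TotLE (a + b - 1) (bracket A B) :=
  ((hA.eulerX.mul hB.derivY).mono (by omega)).sub ((hA.derivY.mul hB.eulerX).mono (by omega))

end Filtrations

/-! ### Evaluation of polynomials at series, and the embedding of `K[x, y]` -/

/-- The evaluation `G ↦ G(A, B)` at two series. -/
noncomputable def evalAt (A B : XInvSeries K) : MvPolynomial (Fin 2) K →+* XInvSeries K :=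
  MvPolynomial.eval₂Hom const ![A, B]

theorem ofPoly_eq_evalAt : (ofPoly : MvPolynomial (Fin 2) K →+* XInvSeries K) =
    evalAt (xMonomial 1 1) (xMonomial 0 Polynomial.X) := rfl

theorem evalAt_C (A B : XInvSeries K) (c : K) : evalAt A B (MvPolynomial.C c) = const c :=
  MvPolynomial.eval₂Hom_C _ _ _

theorem evalAt_X0 (A B : XInvSeries K) : evalAt A B (MvPolynomial.X 0) = A :=
  MvPolynomial.eval₂Hom_X' _ _ _

theorem evalAt_X1 (A B : XInvSeries K) : evalAt A B (MvPolynomial.X 1) = B :=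
  MvPolynomial.eval₂Hom_X' _ _ _

theorem ringHom_eq_evalAt (f : MvPolynomial (Fin 2) K →+* XInvSeries K)
    (hf : ∀ c, f (MvPolynomial.C c) = const c) :
    f = evalAt (f (MvPolynomial.X 0)) (f (MvPolynomial.X 1)) := by
  refine MvPolynomial.ringHom_ext (fun c => by rw [hf, evalAt_C]) fun i => ?_
  fin_cases i
  · exact (evalAt_X0 _ _).symm
  · exact (evalAt_X1 _ _).symm

theorem ofPoly_aeval (P Q G : MvPolynomial (Fin 2) K) :
    ofPoly (MvPolynomial.aeval ![P, Q] G) = evalAt (ofPoly P) (ofPoly Q) G := by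
  have h := ringHom_eq_evalAt
    ((ofPoly : MvPolynomial (Fin 2) K →+* XInvSeries K).comp
      (MvPolynomial.aeval ![P, Q] : MvPolynomial (Fin 2) K →ₐ[K] MvPolynomial (Fin 2) K).toRingHom)
    fun c => by simp [ofPoly_eq_evalAt, evalAt_C, MvPolynomial.algebraMap_eq]
  have := congrArg (fun f => f G) h
  simpa using this

theorem IsDeriv.evalAt {d : XInvSeries K →+ XInvSeries K} (hd : IsDeriv d)
    (hc : ∀ c, d (const c) = 0) (A B : XInvSeries K) (G : MvPolynomial (Fin 2) K) :
    d (evalAt A B G) = evalAt A B (MvPolynomial.pderiv 0 G) * d A +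
      evalAt A B (MvPolynomial.pderiv 1 G) * d B := by
  induction G using MvPolynomial.induction_on with
  | C c => simp [evalAt_C, hc]
  | add p q hp hq => simp only [map_add, hp, hq]; ring
  | mul_X p i hp =>
    rw [map_mul, hd, hp, MvPolynomial.pderiv_mul, MvPolynomial.pderiv_mul]
    fin_cases i
    · simp [evalAt_X0]; ring
    · simp [evalAt_X1]; ring

theorem bracket_evalAt (A B : XInvSeries K) (G : MvPolynomial (Fin 2) K) :
    bracket A (evalAt A B G) = evalAt A B (MvPolynomial.pderiv 1 G) * bracket A B := by
  rw [(isDeriv_bracket A).evalAt (bracket_const A), bracket_self, mul_zero, zero_add]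

theorem eulerX_ofPoly (G : MvPolynomial (Fin 2) K) :
    eulerX (ofPoly G) = ofPoly (MvPolynomial.pderiv 0 G) * xMonomial 1 1 := by
  have h1 : eulerX (xMonomial 1 1 : XInvSeries K) = xMonomial 1 1 := ext_xCoeff fun k => by
    rw [xCoeff_eulerX, xCoeff_xMonomial]
    split_ifs with h <;> simp [h]
  have h2 : eulerX (xMonomial 0 Polynomial.X : XInvSeries K) = 0 := ext_xCoeff fun k => by
    rw [xCoeff_eulerX, xCoeff_xMonomial]
    split_ifs with h <;> simp [h]
  rw [ofPoly_eq_evalAt, (show IsDeriv eulerX from isDeriv_coeffMap 0 1).evalAt eulerX_const, h1, h2, mul_zero, add_zero]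

theorem derivY_ofPoly (G : MvPolynomial (Fin 2) K) :
    derivY (ofPoly G) = ofPoly (MvPolynomial.pderiv 1 G) := by
  have h1 : derivY (xMonomial 1 1 : XInvSeries K) = 0 := ext_xCoeff fun k => by
    rw [xCoeff_derivY, xCoeff_xMonomial]
    split_ifs with h <;> simp
  have h2 : derivY (xMonomial 0 Polynomial.X : XInvSeries K) = 1 := ext_xCoeff fun k => by
    rw [xCoeff_derivY, xCoeff_xMonomial, ← map_one const, const_eq_xMonomial, xCoeff_xMonomial]
    split_ifs with h <;> simp
  rw [ofPoly_eq_evalAt, (show IsDeriv derivY from isDeriv_coeffMap 1 0).evalAt derivY_const, h1, h2, mul_zero, zero_add, mul_one]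

theorem bracket_ofPoly (P Q : MvPolynomial (Fin 2) K) :
    bracket (ofPoly P) (ofPoly Q) = xMonomial 1 1 * ofPoly (jacobian P Q) := by
  rw [bracket_apply, eulerX_ofPoly, eulerX_ofPoly, derivY_ofPoly, derivY_ofPoly, jacobian, map_sub,
    map_mul, map_mul]
  ring

/-- The exponent vector of `x ^ i y ^ j`. -/
noncomputable def expVec (i j : ℕ) : Fin 2 →₀ ℕ := Finsupp.single 0 i + Finsupp.single 1 j

@[simp] theorem expVec_zero (i j : ℕ) : expVec i j 0 = i := by simp [expVec]

@[simp] theorem expVec_one (i j : ℕ) : expVec i j 1 = j := by simp [expVec]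

theorem expVec_self (s : Fin 2 →₀ ℕ) : expVec (s 0) (s 1) = s := by
  ext i
  fin_cases i <;> simp

theorem evalAt_monomial (A B : XInvSeries K) (s : Fin 2 →₀ ℕ) (c : K) :
    evalAt A B (MvPolynomial.monomial s c) = const c * (A ^ s 0 * B ^ s 1) := by
  rw [evalAt, MvPolynomial.coe_eval₂Hom, MvPolynomial.eval₂_monomial,
    Finsupp.prod_fintype _ _ fun i => pow_zero _]
  simp

theorem xMonomial_pow (a : ℤ) (p : Polynomial K) (n : ℕ) :
    xMonomial a p ^ n = xMonomial (n * a) (p ^ n) := by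
  simp [xMonomial, HahnSeries.single_pow]

theorem ofPoly_monomial (s : Fin 2 →₀ ℕ) (c : K) :
    ofPoly (MvPolynomial.monomial s c) =
      xMonomial (s 0) (Polynomial.monomial (s 1) c) := by
  rw [ofPoly_eq_evalAt, evalAt_monomial, xMonomial_pow, xMonomial_pow, xMonomial_mul_xMonomial,
    const_eq_xMonomial, xMonomial_mul_xMonomial, one_pow, one_mul, Polynomial.C_mul_X_pow_eq_monomial]
  simp

theorem xCoeff_ofPoly_coeff (P : MvPolynomial (Fin 2) K) (i j : ℕ) :
    (xCoeff (ofPoly P) i).coeff j = P.coeff (expVec i j) := by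
  induction P using MvPolynomial.induction_on' with
  | monomial s c =>
    rw [ofPoly_monomial, xCoeff_xMonomial, MvPolynomial.coeff_monomial]
    by_cases h : s = expVec i j
    · simp [h]
    · rw [if_neg h]
      split_ifs with h1
      · rw [Polynomial.coeff_monomial, if_neg]
        rintro rfl
        have h2 : i = s 0 := by exact_mod_cast h1
        exact h (by rw [h2, expVec_self])
      · simp
  | add p q hp hq => simp [hp, hq]

theorem xCoeff_ofPoly_of_neg (P : MvPolynomial (Fin 2) K) {k : ℤ} (hk : k < 0) :
    xCoeff (ofPoly P) k = 0 := by
  induction P using MvPolynomial.induction_on' with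
  | monomial s c => rw [ofPoly_monomial, xCoeff_xMonomial, if_neg (by omega)]
  | add p q hp hq => simp [hp, hq]

theorem ofPoly_injective :
    Function.Injective (ofPoly : MvPolynomial (Fin 2) K → XInvSeries K) := fun P Q h => by
  ext s
  rw [← expVec_self s, ← xCoeff_ofPoly_coeff, h, xCoeff_ofPoly_coeff]

theorem ofPoly_C (c : K) : ofPoly (MvPolynomial.C c) = const c := evalAt_C _ _ _

theorem ofPoly_X0 : ofPoly (MvPolynomial.X 0 : MvPolynomial (Fin 2) K) = xMonomial 1 1 :=
  evalAt_X0 _ _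

theorem ofPoly_X1 :
    ofPoly (MvPolynomial.X 1 : MvPolynomial (Fin 2) K) = xMonomial 0 Polynomial.X :=
  evalAt_X1 _ _

theorem totLE_ofPoly_iff (P : MvPolynomial (Fin 2) K) (d : ℕ) :
    TotLE d (ofPoly P) ↔ P.totalDegree ≤ d := by
  have hdeg : ∀ s : Fin 2 →₀ ℕ, (s.sum fun _ e => e) = s 0 + s 1 := fun s => by
    rw [Finsupp.sum_fintype _ _ fun _ => rfl, Fin.sum_univ_two]
  constructor
  · intro h
    refine Finset.sup_le fun s hs => ?_
    rw [hdeg]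
    by_contra hlt
    refine MvPolynomial.mem_support_iff.mp hs ?_
    rw [← expVec_self s, ← xCoeff_ofPoly_coeff]
    exact h _ _ (by omega)
  · intro h k j hk
    rcases lt_or_ge k 0 with hk0 | hk0
    · simp [xCoeff_ofPoly_of_neg P hk0]
    · lift k to ℕ using hk0
      rw [xCoeff_ofPoly_coeff]
      by_contra hne
      have := MvPolynomial.le_totalDegree (MvPolynomial.mem_support_iff.mpr hne)
      rw [hdeg, expVec_zero, expVec_one] at this
      omega

end XInvSeries

/-! ### Weighted leading forms: `x` is not a polynomial in `P` and `Q` -/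

/-- A polynomial all of whose exponents are congruent modulo `p` has degree at least `p` times the
multiplicity of its root `1`. -/
theorem Polynomial.mul_rootMultiplicity_one_le {K : Type*} [Field K] [CharZero K]
    {g : Polynomial K} (hg : g ≠ 0) {p : ℕ} (hp : 0 < p)
    (h : ∀ i ∈ g.support, ∀ j ∈ g.support, i ≡ j [MOD p]) :
    p * g.rootMultiplicity 1 ≤ g.natDegree := by
  set j0 := g.natTrailingDegree with hj0
  set q : Polynomial K := ∑ j ∈ g.support, Polynomial.monomial ((j - j0) / p) (g.coeff j) with hq
  have hgq : g = Polynomial.X ^ j0 * Polynomial.expand K p q := by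
    rw [hq, map_sum, Finset.mul_sum]
    conv_lhs => rw [g.as_sum_support]
    refine Finset.sum_congr rfl fun j hj => ?_
    have hle : j0 ≤ j := Polynomial.natTrailingDegree_le_of_mem_supp j hj
    have hdvd : p ∣ j - j0 :=
      (Nat.modEq_iff_dvd' hle).mp (h _ (Polynomial.natTrailingDegree_mem_support_of_nonzero hg) _ hj)
    rw [Polynomial.expand_monomial, Nat.div_mul_cancel hdvd, ← Polynomial.C_mul_X_pow_eq_monomial,
      ← Polynomial.C_mul_X_pow_eq_monomial, mul_left_comm, ← pow_add, Nat.add_sub_cancel' hle]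
  have hq0 : q ≠ 0 := by
    intro h0
    rw [h0, map_zero, mul_zero] at hgq
    exact hg hgq
  obtain ⟨r, hr, hr'⟩ := Polynomial.exists_eq_pow_rootMultiplicity_mul_and_not_dvd q hq0 1
  set l := q.rootMultiplicity 1 with hl
  have hl' : l ≤ q.natDegree := by
    have h1 := Polynomial.natDegree_le_of_dvd (q.pow_rootMultiplicity_dvd 1) hq0
    rwa [Polynomial.natDegree_pow, Polynomial.natDegree_X_sub_C, mul_one] at h1
  -- Write `q = (X - 1)^l r` with `r(1) ≠ 0`. As `X^p - 1 = (X - 1)(1 + ⋯ + X^(p-1))`, expanding by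
  -- `p` keeps the multiplicity `l` at `1`: the cofactor `w` takes there the value `p^l r(1)`,
  -- nonzero in characteristic zero.
  set w : Polynomial K := Polynomial.X ^ j0 *
    ((∑ i ∈ Finset.range p, Polynomial.X ^ i) ^ l * Polynomial.expand K p r) with hw
  have hgw : g = (Polynomial.X - Polynomial.C 1) ^ l * w := by
    rw [hgq, hr, map_mul, map_pow, map_sub, Polynomial.expand_X, Polynomial.expand_C, map_one,
      ← mul_geom_sum, mul_pow, hw]
    ring
  have hw1 : w.eval 1 ≠ 0 := by
    rw [hw]
    simp only [Polynomial.eval_mul, Polynomial.eval_pow, Polynomial.eval_X, one_pow, one_mul,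
      Polynomial.eval_finsetSum, Polynomial.expand_eval, Finset.sum_const, Finset.card_range,
      nsmul_eq_mul, mul_one]
    refine mul_ne_zero (pow_ne_zero _ (Nat.cast_ne_zero.mpr hp.ne')) fun h0 => hr' ?_
    exact Polynomial.dvd_iff_isRoot.mpr h0
  have hmult : g.rootMultiplicity 1 = l := by
    have hw0 : w ≠ 0 := fun h0 => hw1 (by rw [h0, Polynomial.eval_zero])
    rw [hgw, mul_comm, Polynomial.rootMultiplicity_mul_X_sub_C_pow hw0,
      Polynomial.rootMultiplicity_eq_zero hw1, zero_add]
  have hdeg : g.natDegree = j0 + q.natDegree * p := by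
    rw [hgq, Polynomial.natDegree_X_pow_mul _ ((Polynomial.expand_ne_zero hp).mpr hq0),
      Polynomial.natDegree_expand, add_comm]
  rw [hmult, hdeg, mul_comm]
  exact (Nat.mul_le_mul_right p hl').trans (Nat.le_add_left _ _)

namespace XInvSeries

variable {K : Type*} [Field K]

theorem evalAt_eq_sum (A B : XInvSeries K) (G : MvPolynomial (Fin 2) K) :
    evalAt A B G = ∑ s ∈ G.support, const (G.coeff s) * (A ^ s 0 * B ^ s 1) := by
  conv_lhs => rw [G.as_sum]
  rw [map_sum]
  exact Finset.sum_congr rfl fun s _ => evalAt_monomial A B s _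

theorem xCoeff_sum {ι : Type*} (s : Finset ι) (f : ι → XInvSeries K) (k : ℤ) :
    xCoeff (∑ i ∈ s, f i) k = ∑ i ∈ s, xCoeff (f i) k := by
  classical
  induction s using Finset.induction_on with
  | empty => simp
  | insert a s ha ih => rw [Finset.sum_insert ha, Finset.sum_insert ha, xCoeff_add, ih]

/-- The weight-graded evaluation `u ↦ x ^ n`, `v ↦ y x ^ m`. -/
noncomputable def weightEval (n m : ℕ) : MvPolynomial (Fin 2) K →+* XInvSeries K :=
  evalAt (xMonomial n 1) (xMonomial m Polynomial.X)

theorem weightEval_monomial (n m : ℕ) (s : Fin 2 →₀ ℕ) (c : K) :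
    weightEval n m (MvPolynomial.monomial s c) =
      xMonomial (n * s 0 + m * s 1 : ℕ) (Polynomial.monomial (s 1) c) := by
  rw [weightEval, evalAt_monomial, xMonomial_pow, xMonomial_pow, xMonomial_mul_xMonomial,
    const_eq_xMonomial, xMonomial_mul_xMonomial, one_pow, one_mul,
    Polynomial.C_mul_X_pow_eq_monomial]
  congr 1
  push_cast
  ring

theorem xCoeff_weightEval (n m : ℕ) (G : MvPolynomial (Fin 2) K) (k : ℤ) :
    xCoeff (weightEval n m G) k = ∑ s ∈ G.support,
      if k = (n * s 0 + m * s 1 : ℕ) then Polynomial.monomial (s 1) (G.coeff s) else 0 := by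
  conv_lhs => rw [G.as_sum]
  rw [map_sum, xCoeff_sum]
  exact Finset.sum_congr rfl fun s _ => by rw [weightEval_monomial, xCoeff_xMonomial]

/-- The monomial `u^i v^j` becomes `y^j x^(ni + mj)`, and for `n > 0` the exponent of `y` and the
weight determine `i`; so no terms of `G` collide. -/
theorem xCoeff_weightEval_coeff {n : ℕ} (hn : 0 < n) (m : ℕ) (G : MvPolynomial (Fin 2) K)
    (s : Fin 2 →₀ ℕ) :
    (xCoeff (weightEval n m G) (n * s 0 + m * s 1 : ℕ)).coeff (s 1) = G.coeff s := by
  rw [xCoeff_weightEval, Polynomial.finsetSum_coeff, Finset.sum_eq_single s]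
  · simp
  · intro t _ hts
    split_ifs with h
    · rw [Polynomial.coeff_monomial, if_neg]
      intro h1
      refine hts ?_
      have h2 : t 0 = s 0 := by
        rw [h1] at h
        exact (Nat.eq_of_mul_eq_mul_left hn (by omega)).symm
      rw [← expVec_self t, h1, h2, expVec_self]
    · simp
  · intro hs
    simp [MvPolynomial.notMem_support_iff.mp hs]

theorem exists_of_xCoeff_weightEval_ne_zero {n m : ℕ} {G : MvPolynomial (Fin 2) K} {k : ℤ} {j : ℕ}
    (h : (xCoeff (weightEval n m G) k).coeff j ≠ 0) : ∃ i : ℕ, k = n * i + m * j := by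
  rw [xCoeff_weightEval, Polynomial.finsetSum_coeff] at h
  obtain ⟨s, -, hs⟩ := Finset.exists_ne_zero_of_sum_ne_zero h
  split_ifs at hs with hk
  · rw [Polynomial.coeff_monomial] at hs
    split_ifs at hs with hj
    · exact ⟨s 0, by rw [hk, ← hj]; push_cast; ring⟩
    · exact absurd rfl hs
  · simp at hs

theorem weight_le_of_xle {n : ℕ} (hn : 0 < n) {m : ℕ} {G : MvPolynomial (Fin 2) K} {d : ℤ}
    (h : XLE d (weightEval n m G)) {s : Fin 2 →₀ ℕ} (hs : s ∈ G.support) :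
    ((n * s 0 + m * s 1 : ℕ) : ℤ) ≤ d := by
  by_contra hlt
  refine MvPolynomial.mem_support_iff.mp hs ?_
  rw [← xCoeff_weightEval_coeff hn m, h _ (by omega), Polynomial.coeff_zero]

section Evaluation

variable {A B : XInvSeries K} {n m : ℕ}

theorem XLE.evalAt (hn : 0 < n) (hA : XLE n A) (hB : XLE m B)
    {G : MvPolynomial (Fin 2) K} {d : ℤ} (h : XLE d (weightEval n m G)) :
    XLE d (evalAt A B G) := by
  rw [evalAt_eq_sum]
  refine XLE.sum fun s hs => XLE.const_mul _ ?_
  refine ((hA.pow _).mul (hB.pow _)).mono (le_trans (le_of_eq ?_) (weight_le_of_xle hn h hs))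
  push_cast
  ring

/-- Only the terms of weight `d` reach `x^d`, each through its leading term. The value at `b` can
vanish even when the weighted form does not; this is the cancellation that has to be controlled. -/
theorem MonicX.xCoeff_evalAt (hn : 0 < n) (hA : MonicX n A) (hB : XLE m B) {b : K}
    (hb : xCoeff B m = Polynomial.C b) {G : MvPolynomial (Fin 2) K} {d : ℤ}
    (h : XLE d (weightEval n m G)) :
    xCoeff (evalAt A B G) d = Polynomial.C ((xCoeff (weightEval n m G) d).eval b) := by
  rw [evalAt_eq_sum, xCoeff_sum, xCoeff_weightEval, Polynomial.eval_finsetSum, map_sum]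
  refine Finset.sum_congr rfl fun s hs => ?_
  have hw : ((s 0 : ℕ) : ℤ) * n + (s 1 : ℕ) * m = (n * s 0 + m * s 1 : ℕ) := by
    push_cast
    ring
  have hle := ((hA.pow (s 0)).1.mul (hB.pow (s 1)))
  have htop := ((hA.pow (s 0)).1.xCoeff_mul (hB.pow (s 1)))
  rw [hw] at hle htop
  rw [xCoeff_const_mul]
  split_ifs with hd
  · rw [hd, htop, (hA.pow _).2, hB.xCoeff_pow, hb, one_mul, Polynomial.eval_monomial, map_mul,
      map_pow]
  · have := weight_le_of_xle hn h hs
    rw [hle d (by omega), mul_zero, Polynomial.eval_zero, map_zero]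

/-- Since `v` is sent to `y x^m`, the chain rule makes `∂ᵧ` correspond to `∂ᵥ` times `x^m`. -/
theorem weightEval_iterate_pderiv (n m k : ℕ) (G : MvPolynomial (Fin 2) K) :
    weightEval n m ((MvPolynomial.pderiv 1)^[k] G) * xMonomial (k * m : ℕ) 1 =
      derivY^[k] (weightEval n m G) := by
  have hder : ∀ (a : ℤ), derivY (xMonomial a 1 : XInvSeries K) = 0 := fun a =>
    ext_xCoeff fun k => by
      rw [xCoeff_derivY, xCoeff_xMonomial]
      split_ifs <;> simp
  have hderX : derivY (xMonomial m Polynomial.X : XInvSeries K) = xMonomial m 1 :=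
    ext_xCoeff fun k => by
      rw [xCoeff_derivY, xCoeff_xMonomial, xCoeff_xMonomial]
      split_ifs <;> simp
  induction k with
  | zero =>
    have h1 : (xMonomial 0 1 : XInvSeries K) = 1 := by
      rw [← map_one const, const_eq_xMonomial, map_one]
    simp [h1]
  | succ k ih =>
    rw [Function.iterate_succ_apply', Function.iterate_succ_apply', ← ih,
      show IsDeriv derivY from isDeriv_coeffMap 1 0, hder, mul_zero, zero_add, weightEval,
      (show IsDeriv derivY from isDeriv_coeffMap 1 0).evalAt derivY_const, hder, hderX, mul_zero,
      zero_add, mul_assoc, xMonomial_mul_xMonomial, one_mul]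
    congr 3
    ring

theorem xCoeff_weightEval_iterate_pderiv (n m k : ℕ) (G : MvPolynomial (Fin 2) K) (d : ℤ) :
    xCoeff (weightEval n m ((MvPolynomial.pderiv 1)^[k] G)) (d - k * m) =
      Polynomial.derivative^[k] (xCoeff (weightEval n m G) d) := by
  have h : ∀ H : XInvSeries K,
      xCoeff (derivY^[k] H) d = Polynomial.derivative^[k] (xCoeff H d) := by
    induction k with
    | zero => exact fun _ => rfl
    | succ k ih =>
      intro H
      rw [Function.iterate_succ_apply, ih, xCoeff_derivY, Function.iterate_succ_apply]
  rw [← h, ← weightEval_iterate_pderiv, mul_comm (weightEval _ _ _), xCoeff_xMonomial_mul, one_mul]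
  push_cast
  rfl

/-- By the chain rule the bracket of `A` with `G(A, B)` is `c x` times `G_v(A, B)`, and bracketing
with `A` raises the `x`-degree by at most `n`. -/
theorem xle_evalAt_pderiv (hA : XLE n A) {c : K} (hc : c ≠ 0)
    (hAB : bracket A B = xMonomial 1 (Polynomial.C c)) {G : MvPolynomial (Fin 2) K} {e : ℤ}
    (h : XLE e (evalAt A B G)) : XLE (e + (n - 1)) (evalAt A B (MvPolynomial.pderiv 1 G)) := by
  intro k hk
  have h1 := hA.bracket h (k + 1) (by omega)
  rw [bracket_evalAt, hAB, mul_comm, xCoeff_xMonomial_mul, add_sub_cancel_right] at h1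
  exact (mul_eq_zero.mp h1).resolve_left (by simpa using hc)

/-- `x` is not a polynomial in two series `A`, `B` of bracket a nonzero constant times `x` whose
leading terms are `x ^ n` and `x ^ m`, if neither of `n` and `m` divides the other. -/
theorem evalAt_ne_X [CharZero K] (hnm : ¬ n ∣ m) (hmn : ¬ m ∣ n) (hA : MonicX n A)
    (hB : MonicX m B) {c : K} (hc : c ≠ 0) (hAB : bracket A B = xMonomial 1 (Polynomial.C c))
    (G : MvPolynomial (Fin 2) K) : evalAt A B G ≠ xMonomial 1 1 := by
  intro hG
  have hn0 : 0 < n := Nat.pos_of_ne_zero fun h => hmn (h ▸ dvd_zero m)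
  have hm0 : 0 < m := Nat.pos_of_ne_zero fun h => hnm (h ▸ dvd_zero n)
  have hn1 : n ≠ 1 := fun h => hnm (h ▸ one_dvd m)
  have hm1 : m ≠ 1 := fun h => hmn (h ▸ one_dvd n)
  have hW0 : weightEval n m G ≠ 0 := by
    intro h0
    have : XLE 0 (evalAt A B G) := hA.1.evalAt hn0 hB.1 fun k _ => by rw [h0, xCoeff_zero]
    have h1 := this 1 one_pos
    rw [hG, xCoeff_xMonomial, if_pos rfl] at h1
    exact one_ne_zero h1
  set W := weightEval n m G with hW
  set d : ℤ := -W.order with hd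
  have hWd : XLE d W := fun k hk => HahnSeries.coeff_eq_zero_of_lt_order (by omega)
  set g := xCoeff W d with hg
  have hg0 : g ≠ 0 := by
    rw [hg, xCoeff, hd, neg_neg]
    exact HahnSeries.coeff_order_eq_zero.not.mpr hW0
  set k := g.rootMultiplicity 1 with hk
  -- Differentiating as often as the multiplicity of the root `1` removes the cancellation, since
  -- both leading coefficients of `A` and `B` are `1`.
  have hroot : (Polynomial.derivative^[k] g).eval 1 ≠ 0 := by
    rw [hk, Polynomial.eval_iterate_derivative_rootMultiplicity, nsmul_eq_mul]
    refine mul_ne_zero (Nat.cast_ne_zero.mpr (Nat.factorial_ne_zero _)) ?_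
    exact Polynomial.eval_divByMonic_pow_rootMultiplicity_ne_zero 1 hg0
  have hkW : XLE (d - k * m) (weightEval n m ((MvPolynomial.pderiv 1)^[k] G)) := fun l hl => by
    have := xCoeff_weightEval_iterate_pderiv n m k G (l + k * m)
    rwa [add_sub_cancel_right, ← hW, hWd _ (by omega), Polynomial.iterate_derivative_zero] at this
  have htop : xCoeff (evalAt A B ((MvPolynomial.pderiv 1)^[k] G)) (d - k * m) ≠ 0 := by
    rw [hA.xCoeff_evalAt hn0 hB.1 (hB.2.trans (map_one _).symm) hkW, xCoeff_weightEval_iterate_pderiv]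
    simpa using hroot
  have hbound : ∀ l : ℕ, XLE (1 + l * (n - 1)) (evalAt A B ((MvPolynomial.pderiv 1)^[l] G)) := by
    intro l
    induction l with
    | zero =>
      intro j hj
      rw [Function.iterate_zero_apply, hG, xCoeff_xMonomial, if_neg (by push_cast at hj; omega)]
    | succ l ih =>
      rw [Function.iterate_succ_apply']
      refine (xle_evalAt_pderiv hA.1 hc hAB ih).mono (le_of_eq ?_)
      push_cast
      ring
  have hle : d - k * m ≤ 1 + k * (n - 1) := by
    by_contra hlt
    exact htop (hbound k _ (by omega))
  have hsupp : ∀ j ∈ g.support, ∃ i : ℕ, d = n * i + m * j := fun j hj =>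
    exists_of_xCoeff_weightEval_ne_zero (Polynomial.mem_support_iff.mp hj)
  set q := n.gcd m with hq
  have hq0 : 0 < q := Nat.gcd_pos_of_pos_left _ hn0
  obtain ⟨p, hp⟩ : q ∣ n := Nat.gcd_dvd_left n m
  obtain ⟨r, hr⟩ : q ∣ m := Nat.gcd_dvd_right n m
  have hcop : p.Coprime r := by
    have h1 : q * p.gcd r = q * 1 := by
      rw [← Nat.gcd_mul_left, ← hp, ← hr, mul_one]
    exact Nat.eq_of_mul_eq_mul_left hq0 h1
  have hp2 : 2 ≤ p := by
    rcases Nat.lt_or_ge p 2 with h | h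
    · interval_cases p
      · omega
      · exact absurd (Dvd.intro r (by rw [hp, mul_one, ← hr])) hnm
    · exact h
  have hr2 : 2 ≤ r := by
    rcases Nat.lt_or_ge r 2 with h | h
    · interval_cases r
      · omega
      · exact absurd (Dvd.intro p (by rw [hr, mul_one, ← hp])) hmn
    · exact h
  have hpr : p ≠ r := by
    rintro rfl
    rw [Nat.coprime_self] at hcop
    omega
  have hmod : p * k ≤ g.natDegree := by
    refine Polynomial.mul_rootMultiplicity_one_le hg0 (by omega) fun i hi j hj => ?_
    obtain ⟨a, ha⟩ := hsupp i hi
    obtain ⟨b, hb⟩ := hsupp j hj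
    refine (Nat.modEq_iff_dvd.mpr ?_)
    -- Two monomials of the same weight satisfy `na + mi = nb + mj`; dividing by `q` gives `p ∣ r(j
    -- - i)`, and `p` is prime to `r`.
    have h1 : (q : ℤ) * (r * (j - i)) = q * (p * (a - b)) := by
      have hp' : (n : ℤ) = q * p := by exact_mod_cast hp
      have hr' : (m : ℤ) = q * r := by exact_mod_cast hr
      have h2 := ha.symm.trans hb
      rw [hp', hr'] at h2
      linear_combination -h2
    have h2 := mul_left_cancel₀ (by exact_mod_cast hq0.ne') h1
    exact (Nat.isCoprime_iff_coprime.mpr hcop).dvd_of_dvd_mul_left ⟨_, h2⟩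
  obtain ⟨i, hi⟩ := hsupp _ (Polynomial.natDegree_mem_support_of_nonzero hg0)
  -- Without cancellation the weight of `G` is the `x`-degree `1` of `x`, which is no combination of
  -- `n, m ≥ 2`.
  rcases Nat.eq_zero_or_pos k with hk0 | hk0
  · rw [hk0] at hkW htop
    rw [Function.iterate_zero_apply, hG, xCoeff_xMonomial] at htop
    have hd1 : d = 1 := by
      by_contra h
      rw [if_neg (by simpa using h)] at htop
      exact htop rfl
    rw [hd1] at hi
    have hi' : 1 = n * i + m * g.natDegree := by exact_mod_cast hi
    rcases Nat.eq_zero_or_pos i with h | h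
    · rw [h, mul_zero, zero_add] at hi'
      exact hm1 (Nat.eq_one_of_mul_eq_one_right hi'.symm)
    · have := Nat.mul_le_mul (show 2 ≤ n by omega) h
      omega
  · have h1 : (m : ℤ) * (p * k) ≤ d := by
      rw [hi]
      have h2 : (m : ℤ) * (p * k) ≤ m * g.natDegree := by
        exact_mod_cast Nat.mul_le_mul_left m hmod
      have h3 : (0 : ℤ) ≤ n * i := by positivity
      omega
    -- Comparison of `mpk ≤ d` with `d ≤ 1 + k(m + n - 1)`. The second factor is at least `2`,
    -- because `mp - m - n = q((p - 1)(r - 1) - 1)` and `p ≠ r` are both at least `2`.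
    have h4 : (k : ℤ) * (m * p - m - n + 1) ≤ 1 := by linarith
    have h5 : (2 : ℤ) ≤ m * p - m - n + 1 := by
      have hp' : (n : ℤ) = q * p := by exact_mod_cast hp
      have hr' : (m : ℤ) = q * r := by exact_mod_cast hr
      have h6 : (2 : ℤ) ≤ (p - 1) * (r - 1) := by
        rcases lt_or_gt_of_ne hpr with h | h
        · nlinarith [show (1 : ℤ) ≤ p - 1 by omega, show (2 : ℤ) ≤ r - 1 by omega]
        · nlinarith [show (2 : ℤ) ≤ p - 1 by omega, show (1 : ℤ) ≤ r - 1 by omega]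
      have h7 : (m : ℤ) * p - m - n = q * ((p - 1) * (r - 1) - 1) := by
        rw [hp', hr']
        ring
      rw [h7]
      nlinarith [show (1 : ℤ) ≤ q by omega]
    nlinarith [show (1 : ℤ) ≤ k by omega]

end Evaluation

end XInvSeries

/-! ### From the expansion to a counterexample -/

namespace XInvSeries

variable {K : Type*} [Field K]

theorem TotLE.deg_eq {H : XInvSeries K} {d k : ℤ} {j : ℕ} (h : TotLE d H)
    (hne : (xCoeff H k).coeff j ≠ 0) (hkj : k + j = d) :
    H.deg = ((d : WithTop ℤ) : WithBot (WithTop ℤ)) := by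
  refine IsGreatest.csSup_eq ⟨⟨(k, j), hne, by simp [hkj]⟩, ?_⟩
  rintro _ ⟨⟨i, l⟩, hil, rfl⟩
  have : i * 1 + (l : ℤ) * 1 ≤ d := by
    by_contra hlt
    exact hil (h i l (by omega))
  exact WithBot.coe_le_coe.mpr (WithTop.coe_le_coe.mpr this)

theorem leadingTermX_eq_iff {H : XInvSeries K} {k : ℤ} {p : Polynomial K} (hp : p ≠ 0) :
    H.leadingTermX = xMonomial k p ↔ XLE k H ∧ xCoeff H k = p := by
  constructor
  · intro h
    have h1 := congrArg (fun A => xCoeff A k) h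
    simp only [leadingTermX, xCoeff_xMonomial, if_true] at h1
    have hk : k = -H.order := by
      by_contra hne
      rw [if_neg hne] at h1
      exact hp h1.symm
    rw [if_pos hk, ← hk] at h1
    exact ⟨fun l hl => HahnSeries.coeff_eq_zero_of_lt_order (by omega), h1⟩
  · rintro ⟨h1, h2⟩
    have hne : H.coeff (-k) ≠ 0 := by
      rw [← h2] at hp
      exact hp
    have hH : H ≠ 0 := by
      rintro rfl
      exact hne rfl
    have ho : H.order = -k := by
      refine le_antisymm (HahnSeries.order_le_of_coeff_ne_zero hne) ?_
      by_contra hlt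
      have h3 := h1 (-H.order) (by omega)
      rw [xCoeff, neg_neg] at h3
      exact HahnSeries.coeff_order_eq_zero.not.mpr hH h3
    rw [leadingTermX, ho, neg_neg, h2]

theorem IsNormalized.monicX {C : XInvSeries K} (h : C.IsNormalized) : MonicX 1 C :=
  ⟨h.2.2, h.1⟩

theorem bracket_expansion (u : (XInvSeries K)ˣ) (n : ℕ) (s : Finset ℕ) (lam : ℕ → K) (e : ℕ → ℤ)
    (F : XInvSeries K) :
    bracket ((u : XInvSeries K) ^ n)
      (∑ i ∈ s, const (lam i) * ((u ^ e i : (XInvSeries K)ˣ) : XInvSeries K) + F) =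
      bracket ((u : XInvSeries K) ^ n) F := by
  rw [map_add, map_sum, Finset.sum_eq_zero, zero_add]
  intro i _
  rw [bracket_const_mul, bracket_pow_left, bracket_zpow, mul_zero, mul_zero]

theorem isJacobianCounterexample_of_expansion [CharZero K] {P Q : MvPolynomial (Fin 2) K}
    {C F : XInvSeries K} {n m : ℕ} {lam : ℕ → K} (hnm : ¬ n ∣ m) (hmn : ¬ m ∣ n)
    (hlam : lam 0 = 1) (hC : C.IsNormalized)
    (hF : F.leadingTermX = xMonomial (1 - (n : ℤ)) Polynomial.X) (hP : C ^ n = ofPoly P)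
    (hQ : ofPoly Q = (∑ i ∈ Finset.range (m + n - 2 + 1),
      const (lam i) * C.intPow ((m : ℤ) - (i : ℤ))) + F) :
    IsJacobianCounterexample P Q := by
  have hn0 : n ≠ 0 := fun h => hmn (h ▸ dvd_zero m)
  have hm0 : m ≠ 0 := fun h => hnm (h ▸ dvd_zero n)
  obtain ⟨hF1, hF2⟩ := (leadingTermX_eq_iff Polynomial.X_ne_zero).mp hF
  have hCm := hC.monicX
  obtain ⟨u, rfl⟩ := hC.isUnit
  simp only [intPow_unit] at hQ
  have hPm : MonicX n (ofPoly P) := by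
    rw [← hP]
    simpa using hCm.pow n
  have hQm : MonicX m (ofPoly Q) := by
    have hrest : XLE ((m : ℤ) - 1) (∑ i ∈ Finset.range (m + n - 2),
        const (lam (i + 1)) * ((u ^ ((m : ℤ) - ((i + 1 : ℕ) : ℤ)) : (XInvSeries K)ˣ) :
          XInvSeries K) + F) := by
      refine (XLE.sum fun i _ => ((hCm.zpow _).1.mono ?_).const_mul _).add (hF1.mono (by omega))
      push_cast
      omega
    rw [Finset.sum_range_succ', add_right_comm, hlam, map_one, one_mul, Nat.cast_zero,
      sub_zero] at hQ
    have hlead := hCm.zpow m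
    rw [mul_one] at hlead
    rw [hQ]
    refine ⟨(hrest.mono (by omega)).add hlead.1, ?_⟩
    rw [xCoeff_add, hrest m (by omega), hlead.2, zero_add]
  have hbr : bracket (ofPoly P) (ofPoly Q) = bracket (ofPoly P) F := by
    rw [hQ, ← hP, bracket_expansion]
  have hjac : jacobian P Q = MvPolynomial.C (n : K) := by
    refine ofPoly_injective (ext_xCoeff fun k => ?_)
    have h1 : xCoeff (ofPoly (jacobian P Q)) k = xCoeff (bracket (ofPoly P) F) (k + 1) := by
      rw [← hbr, bracket_ofPoly, xCoeff_xMonomial_mul, one_mul, add_sub_cancel_right]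
    rw [ofPoly_C, const_eq_xMonomial, xCoeff_xMonomial]
    -- Negative powers of `x` are absent because the Jacobian is a polynomial, positive ones because
    -- its bracket form has `x`-degree at most `n + (1 - n) = 1`; at `x^0` the leading terms give
    -- `n`.
    rcases lt_trichotomy k 0 with hk | rfl | hk
    · rw [xCoeff_ofPoly_of_neg _ hk, if_neg hk.ne]
    · rw [h1, if_pos rfl, show (0 : ℤ) + 1 = n + (1 - n) by ring, hPm.xCoeff_bracket hF1, hF2]
      simp
    · rw [h1, if_neg hk.ne']
      exact (hPm.1.bracket hF1) _ (by omega)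
  have hn : (n : K) ≠ 0 := Nat.cast_ne_zero.mpr hn0
  refine ⟨⟨n, hn, hjac⟩, fun haut => ?_⟩
  obtain ⟨G, hG⟩ := haut.2 (MvPolynomial.X 0)
  refine evalAt_ne_X hnm hmn hPm hQm hn ?_ G ?_
  · rw [bracket_ofPoly, hjac, ofPoly_C, const_eq_xMonomial, xMonomial_mul_xMonomial, one_mul,
      add_zero]
  · rw [← ofPoly_aeval, hG, ofPoly_X0]

end XInvSeries

/-! ### Roots of series and expansion in powers of a root -/

namespace XInvSeries

variable {K : Type*} [Field K]

theorem binomialSeries_pow {A : Type*} [CommRing A] [Algebra ℚ A] (r : ℚ) (n : ℕ) :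
    PowerSeries.binomialSeries A r ^ n = PowerSeries.binomialSeries A (n * r) := by
  induction n with
  | zero => simp
  | succ n ih =>
    rw [pow_succ, ih, ← PowerSeries.binomialSeries_add]
    congr 1
    push_cast
    ring

theorem xle_iff_order {H : XInvSeries K} (hH : H ≠ 0) (a : ℤ) : XLE a H ↔ -a ≤ H.order := by
  rw [HahnSeries.le_order_iff_forall hH]
  constructor
  · intro h g hg
    simpa [xCoeff] using h (-g) (by omega)
  · intro h k hk
    exact h _ (by omega)

theorem MonicX.ne_zero {a : ℤ} {A : XInvSeries K} (h : MonicX a A) : A ≠ 0 := by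
  rintro rfl
  exact zero_ne_one h.2

theorem MonicX.isUnit {a : ℤ} {A : XInvSeries K} (h : MonicX a A) : IsUnit A := by
  have hne : A.coeff (-a) ≠ 0 := by
    have h1 : A.coeff (-a) = 1 := h.2
    rw [h1]
    exact one_ne_zero
  have ho : A.order = -a := le_antisymm (HahnSeries.order_le_of_coeff_ne_zero hne)
    ((xle_iff_order h.ne_zero a).mp h.1)
  refine HahnSeries.isUnit_iff.mpr ?_
  rw [HahnSeries.leadingCoeff_eq, ho, show A.coeff (-a) = 1 from h.2]
  exact isUnit_one

theorem MonicX.exists_pow_eq_of_zero [CharZero K] {A : XInvSeries K} (hA : MonicX 0 A) {n : ℕ}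
    (hn : n ≠ 0) : ∃ R : XInvSeries K, MonicX 0 R ∧ R ^ n = A := by
  -- The root is the binomial series `(1 + z)^(1/n)` at `z = A - 1`; positive order is what makes
  -- `PowerSeries.heval` a genuine substitution.
  have hpos : 0 < (A - 1).orderTop := by
    refine (WithTop.coe_lt_coe.mpr zero_lt_one).trans_le
      (HahnSeries.le_orderTop_iff_forall.mpr fun g hg => ?_ : ((1 : ℤ) : WithTop ℤ) ≤ _)
    have hg' : g < 1 := WithTop.coe_lt_coe.mp hg
    have h1 : (A - 1).coeff g = xCoeff A (-g) - xCoeff 1 (-g) := by simp [xCoeff]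
    rw [h1]
    rcases (show g = 0 ∨ g < 0 by omega) with rfl | h
    · rw [neg_zero, hA.2, MonicX.one.2, sub_self]
    · rw [hA.1 _ (by omega), MonicX.one.1 _ (by omega), sub_self]
  set R : XInvSeries K :=
    PowerSeries.heval (A - 1) (PowerSeries.binomialSeries (Polynomial K) (n : ℚ)⁻¹) with hR
  have hRn : R ^ n = A := by
    rw [hR, ← map_pow, binomialSeries_pow, mul_inv_cancel₀ (Nat.cast_ne_zero.mpr hn),
      show (1 : ℚ) = ((1 : ℕ) : ℚ) by norm_num, PowerSeries.binomialSeries_nat, pow_one, map_add,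
      map_one, PowerSeries.heval_X _ hpos, add_sub_cancel]
  refine ⟨R, ⟨?_, ?_⟩, hRn⟩
  · have hR0 : R ≠ 0 := by
      intro h0
      rw [h0, zero_pow hn] at hRn
      exact hA.ne_zero hRn.symm
    have h1 := (xle_iff_order hA.ne_zero 0).mp hA.1
    rw [xle_iff_order hR0]
    rw [← hRn, HahnSeries.order_pow, nsmul_eq_mul] at h1
    by_contra hlt
    have : (0 : ℤ) < n := by omega
    nlinarith
  · rw [xCoeff, neg_zero, hR, PowerSeries.coeff_heval_zero,
      PowerSeries.binomialSeries_constantCoeff]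

theorem monicX_xMonomial (a : ℤ) : MonicX a (xMonomial a 1 : XInvSeries K) :=
  ⟨fun k hk => by rw [xCoeff_xMonomial, if_neg hk.ne'], by rw [xCoeff_xMonomial, if_pos rfl]⟩

/-- A series with leading term `x ^ n` has an `n`-th root with leading term `x`. -/
theorem MonicX.exists_pow_eq [CharZero K] {A : XInvSeries K} {n : ℕ} (hA : MonicX n A)
    (hn : n ≠ 0) : ∃ C : XInvSeries K, MonicX 1 C ∧ C ^ n = A := by
  have h0 : MonicX 0 (xMonomial (-n) 1 * A) := by
    simpa using (monicX_xMonomial (-n)).mul hA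
  obtain ⟨R, hR, hRn⟩ := h0.exists_pow_eq_of_zero hn
  refine ⟨xMonomial 1 1 * R, by simpa using (monicX_xMonomial 1).mul hR, ?_⟩
  rw [mul_pow, hRn, xMonomial_pow, ← mul_assoc, xMonomial_mul_xMonomial, one_pow, mul_one, mul_one,
    add_neg_cancel, show (xMonomial 0 1 : XInvSeries K) = 1 by
      rw [← map_one const, const_eq_xMonomial, map_one], one_mul]

theorem natCast_eq_const (n : ℕ) : (n : XInvSeries K) = const (n : K) := (map_natCast _ n).symm

/-- An `n`-th root of a series of total degree at most `n` has total degree at most `1`. -/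
theorem MonicX.totLE_of_pow [CharZero K] {C : XInvSeries K} {n : ℕ} (hn : n ≠ 0)
    (hC : MonicX 1 C) (h : TotLE n (C ^ n)) : TotLE 1 C := by
  have hmon : MonicX n (C ^ n) := by simpa using hC.pow n
  -- For given `C^n` this equation is linear in `C`, so each coefficient of `C` can be isolated from
  -- the higher ones.
  have hode : eulerX (C ^ n) * C = n * (C ^ n * eulerX C) := by
    rw [(show IsDeriv eulerX from isDeriv_coeffMap 0 1).pow]
    obtain ⟨n, rfl⟩ := Nat.exists_eq_succ_of_ne_zero hn
    rw [Nat.succ_sub_one, pow_succ]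
    ring
  refine descending_induction 0 (fun k hk j hj => ?_) fun k hk ih j hj => ?_
  · rcases (show k = 1 ∨ 1 < k by omega) with rfl | h1
    · rw [hC.2, Polynomial.coeff_one, if_neg (by omega)]
    · rw [hC.1 k h1, Polynomial.coeff_zero]
  · have hT := totLE_truncGT ih
    set T := truncGT k C
    have hR : XLE k (C - T) := xle_sub_truncGT k C
    have hRk : xCoeff (C - T) k = xCoeff C k := xCoeff_sub_truncGT k C
    have h1 : eulerX (C ^ n) * (C - T) - const (n : K) * (C ^ n * eulerX (C - T)) =
        const (n : K) * (C ^ n * eulerX T) - eulerX (C ^ n) * T := by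
      rw [map_sub, ← natCast_eq_const]
      linear_combination hode
    have h2 : TotLE (n + 1) (const (n : K) * (C ^ n * eulerX T) - eulerX (C ^ n) * T) :=
      ((h.mul hT.eulerX).const_mul _).sub (h.eulerX.mul hT)
    have h3 := h2 (n + k) j (by omega)
    rw [← h1, xCoeff_sub, xCoeff_const_mul, hmon.1.eulerX.xCoeff_mul hR,
      hmon.1.xCoeff_mul hR.eulerX, xCoeff_eulerX, xCoeff_eulerX, hmon.2, hRk, one_mul,
      Polynomial.coeff_sub, Polynomial.coeff_C_mul, Polynomial.coeff_smul, smul_mul_assoc, one_mul,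
      Polynomial.coeff_smul, zsmul_eq_mul, zsmul_eq_mul, Int.cast_natCast] at h3
    -- The factor `n(1 - k)` vanishes only at `k = 1`, the leading term, which is known.
    have h4 : (n : K) * ((1 - k : ℤ) : K) * (xCoeff C k).coeff j = 0 := by
      push_cast
      linear_combination h3
    refine (mul_eq_zero.mp h4).resolve_left (mul_ne_zero (Nat.cast_ne_zero.mpr hn) ?_)
    exact Int.cast_ne_zero.mpr (by omega)

section Expansion

variable [CharZero K] {u : (XInvSeries K)ˣ} {n m : ℕ} {B E F : XInvSeries K} {c : K}

/-- Bracketing with `u = x + ⋯` differentiates the leading coefficient with respect to `y`. This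
loses only constant terms, and the bound on the `x`-degree of `F` ensures that a monomial of
excessive total degree has a positive exponent of `y`. -/
theorem totLE_of_bracket (hu : MonicX 1 (u : XInvSeries K)) (hu1 : TotLE 1 (u : XInvSeries K))
    {a : ℤ} (hF : XLE (a - 1) F) (hE : TotLE a (bracket (u : XInvSeries K) F)) : TotLE a F := by
  refine descending_induction (a - 1) (fun k hk j _ => by simp [hF k hk]) fun k hk ih j hj => ?_
  have hT := totLE_truncGT ih
  set T := truncGT k F
  have hR : XLE k (F - T) := xle_sub_truncGT k F
  have hRk : xCoeff (F - T) k = xCoeff F k := xCoeff_sub_truncGT k F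
  have h1 : TotLE a (bracket (u : XInvSeries K) (F - T)) := by
    rw [map_sub]
    exact hE.sub ((hu1.bracket hT).mono (by omega))
  obtain ⟨j, rfl⟩ := Nat.exists_eq_succ_of_ne_zero (show j ≠ 0 by omega)
  have h2 := h1 (1 + k) j (by push_cast at hj; omega)
  rw [hu.xCoeff_bracket hR, hRk, one_smul, Polynomial.coeff_derivative] at h2
  exact (mul_eq_zero.mp h2).resolve_right (by exact_mod_cast Nat.succ_ne_zero j)

/-- Divide `n u^(n-1) [u, B] x = c x` by the monic factor `u^(n-1)`. -/
theorem bracket_root (hn : n ≠ 0) (hu : MonicX 1 (u : XInvSeries K))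
    (hu1 : TotLE 1 (u : XInvSeries K))
    (hB : bracket ((u : XInvSeries K) ^ n) B = xMonomial 1 (Polynomial.C c)) :
    TotLE (2 - n) (bracket (u : XInvSeries K) B) ∧
      xCoeff (bracket (u : XInvSeries K) B) (2 - n) = Polynomial.C (c / n) := by
  have hnK : (n : K) ≠ 0 := Nat.cast_ne_zero.mpr hn
  have h1 : (u : XInvSeries K) ^ (n - 1) * bracket (u : XInvSeries K) B =
      xMonomial 1 (Polynomial.C (c / n)) := by
    rw [bracket_pow_left, mul_assoc, natCast_eq_const] at hB
    have h2 := congrArg (fun A => const (n : K)⁻¹ * A) hB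
    simp only [← mul_assoc, ← map_mul, inv_mul_cancel₀ hnK, map_one, one_mul] at h2
    rw [h2, const_eq_xMonomial, xMonomial_mul_xMonomial, ← map_mul, zero_add, div_eq_inv_mul]
  have hpow := hu.pow (n - 1)
  have hpow1 := hu1.pow (n - 1)
  have hsum : ((n - 1 : ℕ) : ℤ) * 1 + (2 - n) = 1 := by omega
  have hE : TotLE (2 - n) (bracket (u : XInvSeries K) B) := by
    refine hpow1.of_mul_monic hpow.2 ?_
    rw [h1, hsum]
    intro k j hk
    rw [xCoeff_xMonomial]
    split_ifs
    · rw [Polynomial.coeff_C, if_neg (by omega)]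
    · simp
  refine ⟨hE, ?_⟩
  have h3 := hpow.1.xCoeff_mul hE.xle
  rwa [h1, hsum, xCoeff_xMonomial, if_pos rfl, hpow.2, one_mul, eq_comm] at h3

theorem exists_partial_expansion (hu : MonicX 1 (u : XInvSeries K)) (hB : MonicX m B)
    {a : ℤ} (hE : XLE (a + 1) (bracket (u : XInvSeries K) B)) (N : ℕ) (hN : a ≤ m - N) :
    ∃ lam : ℕ → K, (N ≠ 0 → lam 0 = 1) ∧ XLE (m - N) (B - ∑ i ∈ Finset.range N,
      const (lam i) * ((u ^ ((m : ℤ) - (i : ℤ)) : (XInvSeries K)ˣ) : XInvSeries K)) := by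
  induction N with
  | zero => exact ⟨0, fun h => absurd rfl h, by simpa using hB.1⟩
  | succ N ih =>
    push_cast at hN
    obtain ⟨lam, hlam, hX⟩ := ih (by omega)
    set R := B - ∑ i ∈ Finset.range N,
      const (lam i) * ((u ^ ((m : ℤ) - (i : ℤ)) : (XInvSeries K)ˣ) : XInvSeries K) with hR
    have hbr : bracket (u : XInvSeries K) R = bracket (u : XInvSeries K) B := by
      rw [hR, map_sub, map_sum, Finset.sum_eq_zero, sub_zero]
      intro i _
      rw [bracket_const_mul, bracket_zpow, mul_zero]
    -- The bracket with `u` does not see the subtracted powers of `u`, and as long as `m - N > a`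
    -- its coefficient of `x^(m - N + 1)` is zero; so the next coefficient of the remainder is a
    -- constant.
    have hder : Polynomial.derivative (xCoeff R (m - N)) = 0 := by
      have h1 := hu.xCoeff_bracket hX
      rw [hbr, hE _ (by omega), one_smul] at h1
      exact h1.symm
    have hconst := Polynomial.eq_C_of_derivative_eq_zero hder
    set r := (xCoeff R (m - N)).coeff 0
    refine ⟨fun i => if i < N then lam i else r, fun _ => ?_, ?_⟩
    · by_cases hN0 : N = 0
      · subst hN0
        have h2 : xCoeff R (m - (0 : ℕ)) = 1 := by simpa [hR] using hB.2
        rw [h2] at hconst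
        simp only [lt_irrefl, if_false]
        exact Polynomial.C_injective (by rw [← hconst, map_one])
      · simp only [Nat.pos_of_ne_zero hN0, if_true]
        exact hlam hN0
    · have hlead := hu.zpow ((m : ℤ) - (N : ℤ))
      rw [mul_one] at hlead
      have hsum : ∑ i ∈ Finset.range N, const (if i < N then lam i else r) *
          ((u ^ ((m : ℤ) - (i : ℤ)) : (XInvSeries K)ˣ) : XInvSeries K) =
          ∑ i ∈ Finset.range N, const (lam i) *
          ((u ^ ((m : ℤ) - (i : ℤ)) : (XInvSeries K)ˣ) : XInvSeries K) :=
        Finset.sum_congr rfl fun i hi => by rw [if_pos (Finset.mem_range.mp hi)]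
      rw [Finset.sum_range_succ, hsum, ← sub_sub, ← hR]
      simp only [lt_irrefl, if_false]
      intro k hk
      push_cast at hk
      rcases (show k = m - N ∨ (m : ℤ) - N < k by omega) with rfl | hk'
      · rw [xCoeff_sub, xCoeff_const_mul, hlead.2, mul_one, hconst, sub_self]
      · rw [xCoeff_sub, xCoeff_const_mul, hlead.1 _ hk', hX _ hk', mul_zero, sub_zero]

/-- The expansion of the second component of a Jacobian pair in powers of the root of the first
one. -/
theorem exists_expansion (hn : n ≠ 0) (hm : m ≠ 0) (hu : MonicX 1 (u : XInvSeries K))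
    (hu1 : TotLE 1 (u : XInvSeries K)) (hB : MonicX m B)
    (hBu : bracket ((u : XInvSeries K) ^ n) B = xMonomial 1 (Polynomial.C c)) :
    ∃ (lam : ℕ → K) (F : XInvSeries K), lam 0 = 1 ∧ XLE (1 - n) F ∧ TotLE (2 - n) F ∧
      Polynomial.derivative (xCoeff F (1 - n)) = Polynomial.C (c / n) ∧
      B = ∑ i ∈ Finset.range (m + n - 2 + 1),
        const (lam i) * ((u ^ ((m : ℤ) - (i : ℤ)) : (XInvSeries K)ˣ) : XInvSeries K) + F := by
  obtain ⟨hE, hE1⟩ := bracket_root hn hu hu1 hBu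
  obtain ⟨N, hN⟩ : ∃ N, N = m + n - 2 + 1 := ⟨_, rfl⟩
  rw [← hN]
  -- The expansion runs until the remainder has `x`-degree `1 - n`. Since `n` and `m` are positive,
  -- the truncated subtraction gives `N = m + n - 1`.
  have hN' : (m : ℤ) - (N : ℤ) = 1 - n := by omega
  have hE2 : XLE ((1 - n : ℤ) + 1) (bracket (u : XInvSeries K) B) := hE.xle.mono (by omega)
  obtain ⟨lam, hlam, hF⟩ := exists_partial_expansion hu hB hE2 N hN'.ge
  rw [hN'] at hF
  obtain ⟨F, hFdef⟩ : ∃ F, F = B - ∑ i ∈ Finset.range N,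
    const (lam i) * ((u ^ ((m : ℤ) - (i : ℤ)) : (XInvSeries K)ˣ) : XInvSeries K) := ⟨_, rfl⟩
  rw [← hFdef] at hF
  have hBF : B = ∑ i ∈ Finset.range N,
      const (lam i) * ((u ^ ((m : ℤ) - (i : ℤ)) : (XInvSeries K)ˣ) : XInvSeries K) + F := by
    rw [hFdef, add_sub_cancel]
  have hbr : bracket (u : XInvSeries K) F = bracket (u : XInvSeries K) B := by
    have := bracket_expansion u 1 (Finset.range N) lam (fun i => (m : ℤ) - i) F
    rw [← hBF, pow_one] at this
    exact this.symm
  have hE3 : TotLE (2 - n) (bracket (u : XInvSeries K) F) := by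
    rw [hbr]
    exact hE
  refine ⟨lam, F, hlam (by omega), hF, totLE_of_bracket hu hu1 (hF.mono (by omega)) hE3, ?_, hBF⟩
  have h1 := hu.xCoeff_bracket hF
  rw [hbr, one_smul, show (1 : ℤ) + (1 - n) = 2 - n by ring, hE1] at h1
  exact h1.symm

end Expansion

end XInvSeries

/-! ### Polynomial substitutions and Jacobian pairs -/

section Substitution

open MvPolynomial

variable {K : Type*} [Field K]

theorem pderiv_aeval_pair (i : Fin 2) (P Q G : MvPolynomial (Fin 2) K) :
    pderiv i (aeval ![P, Q] G) = aeval ![P, Q] (pderiv 0 G) * pderiv i P +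
      aeval ![P, Q] (pderiv 1 G) * pderiv i Q := by
  induction G using MvPolynomial.induction_on with
  | C c => simp [algebraMap_eq]
  | add p q hp hq => simp only [map_add, hp, hq]; ring
  | mul_X p j hp =>
    rw [map_mul, pderiv_mul, hp, pderiv_mul, pderiv_mul]
    fin_cases j
    · simp; ring
    · simp; ring

theorem jacobian_aeval_pair (P Q f g : MvPolynomial (Fin 2) K) :
    jacobian (aeval ![P, Q] f) (aeval ![P, Q] g) =
      aeval ![P, Q] (jacobian f g) * jacobian P Q := by
  simp only [jacobian, pderiv_aeval_pair, map_sub, map_mul]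
  ring

theorem IsJacobianPair.comp {P Q f g : MvPolynomial (Fin 2) K} (h : IsJacobianPair P Q)
    (h' : IsJacobianPair f g) : IsJacobianPair (aeval ![P, Q] f) (aeval ![P, Q] g) := by
  obtain ⟨c, hc, hPQ⟩ := h
  obtain ⟨d, hd, hfg⟩ := h'
  refine ⟨d * c, mul_ne_zero hd hc, ?_⟩
  rw [jacobian_aeval_pair, hPQ, hfg, aeval_C, algebraMap_eq, C_mul]

theorem aeval_pair_comp (P Q f g : MvPolynomial (Fin 2) K) :
    (aeval ![aeval ![P, Q] f, aeval ![P, Q] g] :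
      MvPolynomial (Fin 2) K →ₐ[K] MvPolynomial (Fin 2) K) =
      (aeval ![P, Q]).comp (aeval ![f, g]) := by
  refine algHom_ext fun i => ?_
  fin_cases i <;> simp

/-- Substituting an automorphism with constant Jacobian into a counterexample. -/
theorem IsJacobianCounterexample.comp_source {P Q f g : MvPolynomial (Fin 2) K}
    (h : IsJacobianCounterexample f g) (hJ : IsJacobianPair P Q) (hA : DefinesAutomorphism P Q) :
    IsJacobianCounterexample (aeval ![P, Q] f) (aeval ![P, Q] g) := by
  refine ⟨hJ.comp h.1, fun h' => h.2 ?_⟩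
  rw [DefinesAutomorphism, aeval_pair_comp, AlgHom.coe_comp] at h'
  exact (Function.Bijective.of_comp_iff' hA _).mp h'

/-- Composing a counterexample with an automorphism with constant Jacobian. -/
theorem IsJacobianCounterexample.comp_target {P Q f g : MvPolynomial (Fin 2) K}
    (h : IsJacobianCounterexample P Q) (hJ : IsJacobianPair f g) (hA : DefinesAutomorphism f g) :
    IsJacobianCounterexample (aeval ![P, Q] f) (aeval ![P, Q] g) := by
  refine ⟨h.1.comp hJ, fun h' => h.2 ?_⟩
  rw [DefinesAutomorphism, aeval_pair_comp, AlgHom.coe_comp] at h'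
  exact (Function.Bijective.of_comp_iff _ hA).mp h'

theorem definesAutomorphism_of_inverse {f g f' g' : MvPolynomial (Fin 2) K}
    (h0 : aeval ![f, g] f' = X 0) (h1 : aeval ![f, g] g' = X 1)
    (h0' : aeval ![f', g'] f = X 0) (h1' : aeval ![f', g'] g = X 1) :
    DefinesAutomorphism f g := by
  refine Function.bijective_iff_has_inverse.mpr
    ⟨aeval ![f', g'], fun G => ?_, fun G => ?_⟩
  · rw [← AlgHom.comp_apply, ← aeval_pair_comp, h0', h1']
    conv_rhs => rw [← aeval_X_left_apply G]
    congr 2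
    funext i
    fin_cases i <;> rfl
  · rw [← AlgHom.comp_apply, ← aeval_pair_comp, h0, h1]
    conv_rhs => rw [← aeval_X_left_apply G]
    congr 2
    funext i
    fin_cases i <;> rfl

theorem IsJacobianCounterexample.swap {P Q : MvPolynomial (Fin 2) K}
    (h : IsJacobianCounterexample P Q) : IsJacobianCounterexample Q P := by
  have := h.comp_target (f := X 1) (g := X 0) ⟨-1, by simp, by simp [jacobian]⟩
    (definesAutomorphism_of_inverse (f' := X 1) (g' := X 0) (by simp) (by simp) (by simp)
      (by simp))
  simpa using this

theorem IsJacobianCounterexample.scale {P Q : MvPolynomial (Fin 2) K}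
    (h : IsJacobianCounterexample P Q) {a b : K} (ha : a ≠ 0) (hb : b ≠ 0) :
    IsJacobianCounterexample (C a * P) (C b * Q) := by
  have := h.comp_target (f := C a * X 0) (g := C b * X 1)
    ⟨a * b, mul_ne_zero ha hb, by simp [jacobian]⟩
    (definesAutomorphism_of_inverse (f' := C a⁻¹ * X 0) (g' := C b⁻¹ * X 1)
      (by simp [algebraMap_eq, ← mul_assoc, ← C_mul, ha])
      (by simp [algebraMap_eq, ← mul_assoc, ← C_mul, hb])
      (by simp [algebraMap_eq, ← mul_assoc, ← C_mul, ha])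
      (by simp [algebraMap_eq, ← mul_assoc, ← C_mul, hb]))
  simpa [algebraMap_eq] using this

theorem IsJacobianCounterexample.sub_pow {P Q : MvPolynomial (Fin 2) K}
    (h : IsJacobianCounterexample P Q) (k : ℕ) : IsJacobianCounterexample P (Q - P ^ k) := by
  have := h.comp_target (f := X 0) (g := X 1 - X 0 ^ k) ⟨1, one_ne_zero, by simp [jacobian]⟩
    (definesAutomorphism_of_inverse (f' := X 0) (g' := X 1 + X 0 ^ k) (by simp) (by simp)
      (by simp) (by simp))
  simpa using this

theorem IsJacobianCounterexample.shear {P Q : MvPolynomial (Fin 2) K}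
    (h : IsJacobianCounterexample P Q) (b : K) :
    IsJacobianCounterexample (aeval ![X 0, X 1 + C b * X 0] P)
      (aeval ![X 0, X 1 + C b * X 0] Q) :=
  h.comp_source ⟨1, one_ne_zero, by simp [jacobian]⟩
    (definesAutomorphism_of_inverse (f' := X 0) (g' := X 1 - C b * X 0) (by simp)
      (by simp [algebraMap_eq]) (by simp) (by simp [algebraMap_eq]))

theorem IsJacobianPair.translate {P Q : MvPolynomial (Fin 2) K} (h : IsJacobianPair P Q)
    (a b : K) :
    IsJacobianPair (aeval ![X 0 - C a * X 1 - C b, X 1] P)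
      (aeval ![X 0 - C a * X 1 - C b, X 1] Q) :=
  IsJacobianPair.comp ⟨1, one_ne_zero, by simp [jacobian]⟩ h

open XInvSeries in
theorem eq_affine_of_totalDegree_le_one {P : MvPolynomial (Fin 2) K} (h : P.totalDegree ≤ 1) :
    ∃ a b c : K, P = C a * X 0 + C b * X 1 + C c := by
  refine ⟨P.coeff (expVec 1 0), P.coeff (expVec 0 1), P.coeff (expVec 0 0), ?_⟩
  have hinj : ∀ i j i' j', expVec i j = expVec i' j' ↔ i = i' ∧ j = j' := fun i j i' j' =>
    ⟨fun h => ⟨by simpa using congrArg (fun s => s 0) h, by simpa using congrArg (fun s => s 1) h⟩,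
      fun h => by rw [h.1, h.2]⟩
  ext s
  rw [← expVec_self s]
  generalize s 0 = i
  generalize s 1 = j
  have hX0 : (Finsupp.single 0 1 : Fin 2 →₀ ℕ) = expVec 1 0 := by simp [expVec]
  have hX1 : (Finsupp.single 1 1 : Fin 2 →₀ ℕ) = expVec 0 1 := by simp [expVec]
  have h00 : (0 : Fin 2 →₀ ℕ) = expVec 0 0 := by simp [expVec]
  rw [coeff_add, coeff_add, coeff_C_mul, coeff_C_mul, coeff_X, coeff_X, coeff_C, hX0, hX1, h00]
  simp only [hinj]
  rcases (show (i = 0 ∧ j = 0) ∨ (i = 1 ∧ j = 0) ∨ (i = 0 ∧ j = 1) ∨ 1 < i + j by omega) with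
    ⟨rfl, rfl⟩ | ⟨rfl, rfl⟩ | ⟨rfl, rfl⟩ | hij
  · simp
  · simp
  · simp
  · have h0 : P.coeff (expVec i j) = 0 := by
      rw [← xCoeff_ofPoly_coeff]
      exact (totLE_ofPoly_iff P 1).mpr h i j (by push_cast; omega)
    rw [h0, if_neg (by omega), if_neg (by omega), if_neg (by omega)]
    simp

theorem definesAutomorphism_of_totalDegree_le_one {P Q : MvPolynomial (Fin 2) K}
    (hP : P.totalDegree ≤ 1) (hQ : Q.totalDegree ≤ 1) (h : IsJacobianPair P Q) :
    DefinesAutomorphism P Q := by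
  obtain ⟨a, b, e, rfl⟩ := eq_affine_of_totalDegree_le_one hP
  obtain ⟨a', b', e', rfl⟩ := eq_affine_of_totalDegree_le_one hQ
  obtain ⟨c, hc, hj⟩ := h
  have hdet : a * b' - b * a' = c := by
    apply C_injective (Fin 2) K
    rw [← hj]
    simp [jacobian]
  have hinv : (C c * C c⁻¹ : MvPolynomial (Fin 2) K) = 1 := by
    rw [← C_mul, mul_inv_cancel₀ hc, C_1]
  have hdet' : (C a * C b' - C b * C a' : MvPolynomial (Fin 2) K) = C c := by
    rw [← hdet]; simp
  refine definesAutomorphism_of_inverse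
    (f' := C c⁻¹ * (C b' * (X 0 - C e) - C b * (X 1 - C e')))
    (g' := C c⁻¹ * (C a * (X 1 - C e') - C a' * (X 0 - C e))) ?_ ?_ ?_ ?_
  · simp [algebraMap_eq]
    linear_combination (X 0 : MvPolynomial (Fin 2) K) * hinv + C c⁻¹ * X 0 * hdet'
  · simp [algebraMap_eq]
    linear_combination (X 1 : MvPolynomial (Fin 2) K) * hinv + C c⁻¹ * X 1 * hdet'
  · simp [algebraMap_eq]
    linear_combination (X 0 - C e : MvPolynomial (Fin 2) K) * hinv + C c⁻¹ * (X 0 - C e) * hdet'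
  · simp [algebraMap_eq]
    linear_combination (X 1 - C e' : MvPolynomial (Fin 2) K) * hinv + C c⁻¹ * (X 1 - C e') * hdet'

end Substitution

/-! ### Minimal counterexamples in general position -/

namespace XInvSeries

open MvPolynomial (aeval X)

variable {K : Type*} [Field K]

theorem TotLE.evalAt {A B : XInvSeries K} (hA : TotLE 1 A) (hB : TotLE 1 B)
    {P : MvPolynomial (Fin 2) K} {d : ℕ} (hP : P.totalDegree ≤ d) : TotLE d (evalAt A B P) := by
  rw [evalAt_eq_sum]
  refine TotLE.sum fun s hs => TotLE.const_mul _ (((hA.pow _).mul (hB.pow _)).mono ?_)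
  have h1 := MvPolynomial.le_totalDegree hs
  rw [Finsupp.sum_fintype _ _ fun _ => rfl, Fin.sum_univ_two] at h1
  omega

theorem totLE_one_of_totalDegree {P : MvPolynomial (Fin 2) K} (hP : P.totalDegree ≤ 1) :
    TotLE 1 (ofPoly P) := (totLE_ofPoly_iff P 1).mpr hP

theorem totalDegree_aeval_le {f g P : MvPolynomial (Fin 2) K} (hf : f.totalDegree ≤ 1)
    (hg : g.totalDegree ≤ 1) : (aeval ![f, g] P).totalDegree ≤ P.totalDegree := by
  rw [← totLE_ofPoly_iff, ofPoly_aeval]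
  exact (totLE_one_of_totalDegree hf).evalAt (totLE_one_of_totalDegree hg) le_rfl

theorem totLE_xMonomial {a d : ℤ} {p : Polynomial K} (h : a + p.natDegree ≤ d) :
    TotLE d (xMonomial a p) := fun k j hk => by
  rw [xCoeff_xMonomial]
  split_ifs with hka
  · exact Polynomial.coeff_eq_zero_of_natDegree_lt (by omega)
  · simp

theorem xle_weightEval_of_totalDegree_le {P : MvPolynomial (Fin 2) K} {d : ℕ}
    (hP : P.totalDegree ≤ d) : XLE d (weightEval 1 1 P) := by
  rw [weightEval, evalAt_eq_sum]
  refine XLE.sum fun s hs => XLE.const_mul _ ?_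
  have h1 := MvPolynomial.le_totalDegree hs
  rw [Finsupp.sum_fintype _ _ fun _ => rfl, Fin.sum_univ_two] at h1
  rw [xMonomial_pow, xMonomial_pow, xMonomial_mul_xMonomial]
  intro k hk
  rw [xCoeff_xMonomial, if_neg]
  push_cast
  omega

theorem xCoeff_weightEval_ne_zero {P : MvPolynomial (Fin 2) K} (hP : P.totalDegree ≠ 0) :
    xCoeff (weightEval 1 1 P) P.totalDegree ≠ 0 := by
  intro h0
  have hle : XLE (P.totalDegree - 1 : ℤ) (weightEval 1 1 P) := fun k hk => by
    rcases (show k = P.totalDegree ∨ (P.totalDegree : ℤ) < k by omega) with rfl | h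
    · exact h0
    · exact xle_weightEval_of_totalDegree_le le_rfl k h
  have hlt : P.totalDegree ≤ P.totalDegree - 1 := by
    refine Finset.sup_le fun s hs => ?_
    have := weight_le_of_xle one_pos hle hs
    rw [Finsupp.sum_fintype _ _ fun _ => rfl, Fin.sum_univ_two]
    omega
  omega

/-- After a generic shear the coefficients of the highest powers of `x` do not vanish. -/
theorem exists_shear [CharZero K] {P Q : MvPolynomial (Fin 2) K} (hP : P.totalDegree ≠ 0)
    (hQ : Q.totalDegree ≠ 0) : ∃ b p q : K, p ≠ 0 ∧ q ≠ 0 ∧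
      xCoeff (ofPoly (aeval ![X 0, X 1 + MvPolynomial.C b * X 0] P)) P.totalDegree =
        Polynomial.C p ∧
      xCoeff (ofPoly (aeval ![X 0, X 1 + MvPolynomial.C b * X 0] Q)) Q.totalDegree =
        Polynomial.C q := by
  have hne := mul_ne_zero (xCoeff_weightEval_ne_zero hP) (xCoeff_weightEval_ne_zero hQ)
  -- With weights `(1, 1)` these coefficients are the top homogeneous forms at `(1, y)`, and the
  -- shear `y ↦ y + bx` makes their values at `b` the coefficients of the top powers of `x`. An
  -- infinite field has a `b` avoiding all roots.
  obtain ⟨b, hb⟩ : ∃ b, (xCoeff (weightEval 1 1 P) P.totalDegree *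
      xCoeff (weightEval 1 1 Q) Q.totalDegree).eval b ≠ 0 := by
    by_contra! hall
    exact hne (Polynomial.funext fun b => by rw [hall, Polynomial.eval_zero])
  rw [Polynomial.eval_mul] at hb
  have hY : XLE (1 : ℕ) (ofPoly (X 1 + MvPolynomial.C b * X 0)) ∧
      xCoeff (ofPoly (X 1 + MvPolynomial.C b * X 0)) (1 : ℕ) = Polynomial.C b := by
    rw [map_add, map_mul, ofPoly_X1, ofPoly_C, ofPoly_X0]
    refine ⟨fun k hk => ?_, ?_⟩
    · push_cast at hk
      rw [xCoeff_add, xCoeff_const_mul, xCoeff_xMonomial, xCoeff_xMonomial, if_neg (by omega),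
        if_neg (by omega), mul_zero, add_zero]
    · rw [xCoeff_add, xCoeff_const_mul, xCoeff_xMonomial, xCoeff_xMonomial, if_neg (by simp),
        if_pos (by simp), mul_one, zero_add]
  have hX : MonicX (1 : ℕ) (ofPoly (X 0 : MvPolynomial (Fin 2) K)) := by
    rw [ofPoly_X0]
    exact monicX_xMonomial 1
  refine ⟨b, _, _, left_ne_zero_of_mul hb, right_ne_zero_of_mul hb, ?_, ?_⟩
  · rw [ofPoly_aeval, hX.xCoeff_evalAt one_pos hY.1 hY.2 (xle_weightEval_of_totalDegree_le le_rfl)]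
  · rw [ofPoly_aeval, hX.xCoeff_evalAt one_pos hY.1 hY.2 (xle_weightEval_of_totalDegree_le le_rfl)]

theorem totalDegree_ne_zero_of_jacobian {P Q : MvPolynomial (Fin 2) K} (h : IsJacobianPair P Q) :
    P.totalDegree ≠ 0 ∧ Q.totalDegree ≠ 0 := by
  obtain ⟨c, hc, hj⟩ := h
  have hC : (MvPolynomial.C c : MvPolynomial (Fin 2) K) ≠ 0 := by simpa using hc
  refine ⟨fun h0 => hC ?_, fun h0 => hC ?_⟩
  · rw [MvPolynomial.totalDegree_eq_zero_iff_eq_C] at h0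
    rw [← hj, h0]
    simp [jacobian]
  · rw [MvPolynomial.totalDegree_eq_zero_iff_eq_C] at h0
    rw [← hj, h0]
    simp [jacobian]

/-- A counterexample of minimal total degree in general position. -/
theorem exists_minimal_counterexample [CharZero K] (h : ¬ JacobianConjecture K) :
    ∃ (P Q : MvPolynomial (Fin 2) K) (n m : ℕ), n ≠ 0 ∧ m ≠ 0 ∧ IsJacobianCounterexample P Q ∧
      TotLE n (ofPoly P) ∧ TotLE m (ofPoly Q) ∧ xCoeff (ofPoly P) n = 1 ∧
      xCoeff (ofPoly Q) m = 1 ∧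
      ∀ P' Q' : MvPolynomial (Fin 2) K, IsJacobianCounterexample P' Q' →
        n + m ≤ P'.totalDegree + Q'.totalDegree := by
  classical
  have hex : ∃ N, ∃ P Q : MvPolynomial (Fin 2) K, IsJacobianCounterexample P Q ∧
      P.totalDegree + Q.totalDegree = N := by
    simp only [JacobianConjecture, not_forall] at h
    obtain ⟨P, Q, h1, h2⟩ := h
    exact ⟨_, P, Q, ⟨h1, h2⟩, rfl⟩
  obtain ⟨P, Q, hPQ, hN⟩ := Nat.find_spec hex
  obtain ⟨hP, hQ⟩ := totalDegree_ne_zero_of_jacobian hPQ.1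
  obtain ⟨b, p, q, hp, hq, hpP, hqQ⟩ := exists_shear hP hQ
  have hf : (X 0 : MvPolynomial (Fin 2) K).totalDegree ≤ 1 := (MvPolynomial.totalDegree_X _).le
  have hg : (X 1 + MvPolynomial.C b * X 0 : MvPolynomial (Fin 2) K).totalDegree ≤ 1 := by
    rw [← totLE_ofPoly_iff, map_add, map_mul, ofPoly_X1, ofPoly_C, ofPoly_X0]
    exact (totLE_xMonomial (by simp)).add ((totLE_xMonomial (by simp)).const_mul _)
  refine ⟨_, _, P.totalDegree, Q.totalDegree, hP, hQ,
    (hPQ.shear b).scale (inv_ne_zero hp) (inv_ne_zero hq), ?_, ?_, ?_, ?_, fun P' Q' h' => ?_⟩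
  · rw [map_mul, ofPoly_C]
    exact TotLE.const_mul _ ((totLE_ofPoly_iff _ _).mpr (totalDegree_aeval_le hf hg))
  · rw [map_mul, ofPoly_C]
    exact TotLE.const_mul _ ((totLE_ofPoly_iff _ _).mpr (totalDegree_aeval_le hf hg))
  · rw [map_mul, ofPoly_C, xCoeff_const_mul, hpP, ← map_mul, inv_mul_cancel₀ hp, map_one]
  · rw [map_mul, ofPoly_C, xCoeff_const_mul, hqQ, ← map_mul, inv_mul_cancel₀ hq, map_one]
  · rw [hN]
    exact Nat.find_min' hex ⟨P', Q', h', rfl⟩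

/-- The expansion of a Jacobian pair in general position. -/
theorem exists_root_expansion [CharZero K] {P Q : MvPolynomial (Fin 2) K} {n m : ℕ} (hn : n ≠ 0)
    (hm : m ≠ 0) (h : IsJacobianPair P Q) (hP : TotLE n (ofPoly P)) (hQ : TotLE m (ofPoly Q))
    (hP1 : xCoeff (ofPoly P) n = 1) (hQ1 : xCoeff (ofPoly Q) m = 1) :
    ∃ (u : (XInvSeries K)ˣ) (lam : ℕ → K) (F : XInvSeries K) (c : K), c ≠ 0 ∧
      MonicX 1 (u : XInvSeries K) ∧ TotLE 1 (u : XInvSeries K) ∧ (u : XInvSeries K) ^ n = ofPoly P ∧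
      lam 0 = 1 ∧ XLE (1 - n) F ∧ TotLE (2 - n) F ∧
      Polynomial.derivative (xCoeff F (1 - n)) = Polynomial.C c ∧
      ofPoly Q = ∑ i ∈ Finset.range (m + n - 2 + 1),
        const (lam i) * ((u ^ ((m : ℤ) - (i : ℤ)) : (XInvSeries K)ˣ) : XInvSeries K) + F := by
  obtain ⟨c, hc, hj⟩ := h
  have hPm : MonicX n (ofPoly P) := ⟨hP.xle, hP1⟩
  obtain ⟨C, hC, hCn⟩ := hPm.exists_pow_eq hn
  have hC1 : TotLE 1 C := hC.totLE_of_pow hn (hCn.symm ▸ hP)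
  obtain ⟨u, rfl⟩ := hC.isUnit
  have hbr : bracket ((u : XInvSeries K) ^ n) (ofPoly Q) = xMonomial 1 (Polynomial.C c) := by
    rw [hCn, bracket_ofPoly, hj, ofPoly_C, const_eq_xMonomial, xMonomial_mul_xMonomial, one_mul,
      add_zero]
  obtain ⟨lam, F, h0, h1, h2, h3, h4⟩ := exists_expansion hn hm hC hC1 ⟨hQ.xle, hQ1⟩ hbr
  exact ⟨u, lam, F, c / n, div_ne_zero hc (Nat.cast_ne_zero.mpr hn), hC, hC1, hCn, h0, h1, h2, h3,
    h4⟩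

/-- If `m = nk` then `P^k` is the term `C^m` of the expansion of `Q`, and every other term has total
degree below `m`; so `(P, Q - P^k)` is a smaller counterexample. -/
theorem not_dvd_of_minimal [CharZero K] {P Q : MvPolynomial (Fin 2) K} {n m : ℕ} (hn : n ≠ 0)
    (hm : m ≠ 0) (h : IsJacobianCounterexample P Q) (hP : TotLE n (ofPoly P))
    (hQ : TotLE m (ofPoly Q)) (hP1 : xCoeff (ofPoly P) n = 1) (hQ1 : xCoeff (ofPoly Q) m = 1)
    (hmin : ∀ P' Q' : MvPolynomial (Fin 2) K, IsJacobianCounterexample P' Q' →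
      n + m ≤ P'.totalDegree + Q'.totalDegree) : ¬ n ∣ m := by
  rintro ⟨k, hk⟩
  have hPdeg := (totLE_ofPoly_iff P n).mp hP
  have hQdeg := (totLE_ofPoly_iff Q m).mp hQ
  -- The bound `2 - n ≤ m - 1` on the degree of `F` needs `n + m ≥ 3`; below that the pair is
  -- affine, hence an automorphism.
  by_cases h2 : n + m ≤ 2
  · exact h.2 (definesAutomorphism_of_totalDegree_le_one (by omega) (by omega) h.1)
  · obtain ⟨u, lam, F, c, -, hu, hu1, hun, hlam, -, hF, -, hexp⟩ :=
      exists_root_expansion hn hm h.1 hP hQ hP1 hQ1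
    have hpow : ofPoly (P ^ k) = ((u ^ (m : ℤ) : (XInvSeries K)ˣ) : XInvSeries K) := by
      rw [map_pow, ← hun, ← pow_mul, ← hk]
      simp
    have hsub : ofPoly (Q - P ^ k) = ∑ i ∈ Finset.range (m + n - 2), const (lam (i + 1)) *
        ((u ^ ((m : ℤ) - ((i + 1 : ℕ) : ℤ)) : (XInvSeries K)ˣ) : XInvSeries K) + F := by
      rw [map_sub, hpow, hexp, Finset.sum_range_succ', hlam, map_one, one_mul, Nat.cast_zero,
        sub_zero, add_right_comm, add_sub_cancel_right]
    have hdeg : TotLE ((m - 1 : ℕ) : ℤ) (ofPoly (Q - P ^ k)) := by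
      rw [hsub]
      refine (TotLE.sum fun i _ => ((hu1.zpow hu.2 _).mono ?_).const_mul _).add
        (hF.mono (by omega))
      push_cast
      omega
    have := hmin _ _ (h.sub_pow k)
    have h3 := (totLE_ofPoly_iff _ _).mp hdeg
    omega

end XInvSeries

/-! ### Normalisation of `C` and `F` -/

namespace XInvSeries

open MvPolynomial (aeval X)

variable {K : Type*} [Field K]

/-- Factor out `A - B`: the cofactor is a sum of `n` products with leading term `x^(n-1)`. -/
theorem MonicX.pow_sub_pow {A B : XInvSeries K} (hA : MonicX 1 A) (hB : MonicX 1 B) {e : ℤ}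
    (h : XLE e (A - B)) (n : ℕ) :
    XLE (n - 1 + e) (A ^ n - B ^ n) ∧
      xCoeff (A ^ n - B ^ n) (n - 1 + e) = (n : Polynomial K) * xCoeff (A - B) e := by
  have hterm : ∀ i ∈ Finset.range n, MonicX (n - 1) (A ^ i * B ^ (n - 1 - i)) := fun i hi => by
    have hi' := Finset.mem_range.mp hi
    have := (hA.pow i).mul (hB.pow (n - 1 - i))
    rwa [show (i : ℤ) * 1 + ((n - 1 - i : ℕ) : ℤ) * 1 = n - 1 by omega] at this
  have hS : XLE (n - 1) (∑ i ∈ Finset.range n, A ^ i * B ^ (n - 1 - i)) :=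
    XLE.sum fun i hi => (hterm i hi).1
  rw [← (Commute.all A B).geom_sum₂_mul]
  refine ⟨hS.mul h, ?_⟩
  rw [hS.xCoeff_mul h, xCoeff_sum, Finset.sum_congr rfl fun i hi => (hterm i hi).2]
  simp

/-- The translation of `x` that kills the coefficient of `x ^ (n - 1)` in a polynomial. -/
theorem exists_tschirnhaus [CharZero K] {P : MvPolynomial (Fin 2) K} {n : ℕ} (hn : n ≠ 0)
    (hP : TotLE n (ofPoly P)) (hP1 : xCoeff (ofPoly P) n = 1) :
    ∃ a b : K, XLE (n - 2)
      (ofPoly (aeval ![X 0 - MvPolynomial.C a * X 1 - MvPolynomial.C b, X 1] P) -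
        xMonomial 1 1 ^ n) := by
  obtain ⟨C, hC, hCn⟩ := MonicX.exists_pow_eq (⟨hP.xle, hP1⟩ : MonicX n (ofPoly P)) hn
  have hC1 : TotLE 1 C := hC.totLE_of_pow hn (hCn.symm ▸ hP)
  -- The coefficient of `x^0` in the root `C` has degree at most `1` in `y` because `C` has total
  -- degree at most `1`. Hence `x + ay + b` is a polynomial agreeing with `C` down to `x^0`.
  obtain ⟨a, b, hab⟩ := Polynomial.exists_eq_X_add_C_of_natDegree_le_one
    (p := xCoeff C 0) (Polynomial.natDegree_le_iff_coeff_eq_zero.mpr fun j hj =>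
      hC1 0 j (by omega))
  refine ⟨a, b, ?_⟩
  set f : MvPolynomial (Fin 2) K := X 0 - MvPolynomial.C a * X 1 - MvPolynomial.C b with hf
  set L : MvPolynomial (Fin 2) K := X 0 + MvPolynomial.C a * X 1 + MvPolynomial.C b with hL
  have hLs : ofPoly L = xMonomial 1 1 + xMonomial 0 (xCoeff C 0) := by
    rw [hL, map_add, map_add, map_mul, ofPoly_C, ofPoly_C, ofPoly_X0, ofPoly_X1, add_assoc, hab]
    congr 1
    refine ext_xCoeff fun k => ?_
    rw [xCoeff_add, xCoeff_const_mul, const_eq_xMonomial, xCoeff_xMonomial, xCoeff_xMonomial,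
      xCoeff_xMonomial]
    split_ifs <;> simp
  have hLc : ∀ k, xCoeff (ofPoly L) k =
      (if k = 1 then 1 else 0) + if k = 0 then xCoeff C 0 else 0 := fun k => by
    rw [hLs, xCoeff_add, xCoeff_xMonomial, xCoeff_xMonomial]
  have hLm : MonicX 1 (ofPoly L) := by
    refine ⟨fun k hk => ?_, ?_⟩
    · rw [hLc, if_neg (by omega), if_neg (by omega), add_zero]
    · rw [hLc, if_pos rfl, if_neg (by omega), add_zero]
  have hCL : XLE (-1) (C - ofPoly L) := fun k hk => by
    rw [xCoeff_sub, hLc]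
    rcases (show k = 0 ∨ k = 1 ∨ 1 < k by omega) with rfl | rfl | hk1
    · rw [if_neg (by omega), if_pos rfl, zero_add, sub_self]
    · rw [hC.2, if_pos rfl, if_neg (by omega), add_zero, sub_self]
    · rw [hC.1 k hk1, if_neg (by omega), if_neg (by omega), add_zero, sub_zero]
  have hR : XLE (n - 2) (ofPoly (P - L ^ n)) := by
    rw [map_sub, map_pow, ← hCn]
    exact (hC.pow_sub_pow hLm hCL n).1.mono (by omega)
  have hX : (X 0 : MvPolynomial (Fin 2) K) = aeval ![f, X 1] L := by
    rw [hL, hf]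
    simp only [map_add, map_mul, MvPolynomial.aeval_X, MvPolynomial.aeval_C,
      MvPolynomial.algebraMap_eq, Matrix.cons_val_zero, Matrix.cons_val_one]
    ring
  have hfm : XLE (1 : ℕ) (ofPoly f) := by
    rw [hf, map_sub, map_sub, map_mul, ofPoly_C, ofPoly_C, ofPoly_X0, ofPoly_X1]
    refine ((monicX_xMonomial 1).1.sub (XLE.const_mul _ fun k hk => ?_)).sub
      ((XLE.const b).mono (by simp))
    rw [xCoeff_xMonomial, if_neg (by omega)]
  have hYm : XLE (0 : ℕ) (ofPoly (X 1 : MvPolynomial (Fin 2) K)) := by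
    rw [ofPoly_X1]
    intro k hk
    rw [xCoeff_xMonomial, if_neg (by push_cast at hk; omega)]
  rw [← ofPoly_X0, hX, ← map_pow, ← map_sub, ← map_pow, ← map_sub, ofPoly_aeval]
  -- For the weights `1` and `0` of `x` and `y`, `weightEval` is the embedding `ofPoly` itself, so
  -- this says that the substitution does not raise the `x`-degree.
  exact XLE.evalAt one_pos hfm hYm hR

/-- The automorphism of `K[y]((x⁻¹))` given by an endomorphism of `K[y]`. -/
noncomputable def mapCoeff (σ : Polynomial K →+* Polynomial K) : XInvSeries K →+* XInvSeries K where
  toFun A := A.map σ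
  map_zero' := by ext1; funext g; simp
  map_one' := by
    ext1; funext g
    rw [HahnSeries.map_coeff, HahnSeries.coeff_one]
    split_ifs <;> simp
  map_add' A B := by ext1; funext g; simp
  map_mul' A B := HahnSeries.map_mul (σ : Polynomial K →ₙ+* Polynomial K)

theorem xCoeff_mapCoeff (σ : Polynomial K →+* Polynomial K) (A : XInvSeries K) (k : ℤ) :
    xCoeff (mapCoeff σ A) k = σ (xCoeff A k) := rfl

theorem mapCoeff_xMonomial (σ : Polynomial K →+* Polynomial K) (k : ℤ) (p : Polynomial K) :
    mapCoeff σ (xMonomial k p) = xMonomial k (σ p) := ext_xCoeff fun j => by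
  rw [xCoeff_mapCoeff, xCoeff_xMonomial, xCoeff_xMonomial]
  split_ifs <;> simp

/-- Substitution of `a y + b` for `y`. -/
noncomputable def affineSubst (a b : K) : Polynomial K →+* Polynomial K :=
  Polynomial.compRingHom (Polynomial.C a * Polynomial.X + Polynomial.C b)

theorem affineSubst_C (a b c : K) : affineSubst a b (Polynomial.C c) = Polynomial.C c := by
  simp [affineSubst]

theorem affineSubst_X (a b : K) :
    affineSubst a b Polynomial.X = Polynomial.C a * Polynomial.X + Polynomial.C b := by
  simp [affineSubst]

theorem mapCoeff_const (a b c : K) : mapCoeff (affineSubst a b) (const c) = const c := by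
  rw [const_eq_xMonomial, mapCoeff_xMonomial, affineSubst_C]

theorem mapCoeff_ofPoly (a b : K) (P : MvPolynomial (Fin 2) K) :
    mapCoeff (affineSubst a b) (ofPoly P) =
      ofPoly (aeval ![X 0, MvPolynomial.C a * X 1 + MvPolynomial.C b] P) := by
  have h := ringHom_eq_evalAt ((mapCoeff (affineSubst a b)).comp ofPoly) fun c => by
    rw [RingHom.comp_apply, ofPoly_C, mapCoeff_const]
  have h1 : ofPoly (MvPolynomial.C a * X 1 + MvPolynomial.C b) =
      mapCoeff (affineSubst a b) (ofPoly (X 1)) := by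
    rw [map_add, map_mul, ofPoly_C, ofPoly_C, ofPoly_X1, mapCoeff_xMonomial, affineSubst_X]
    refine ext_xCoeff fun k => ?_
    rw [xCoeff_add, xCoeff_const_mul, const_eq_xMonomial, xCoeff_xMonomial, xCoeff_xMonomial,
      xCoeff_xMonomial]
    split_ifs <;> simp
  have h0 : ofPoly (X 0) = mapCoeff (affineSubst a b) (ofPoly (X 0 : MvPolynomial (Fin 2) K)) := by
    rw [ofPoly_X0, mapCoeff_xMonomial, map_one]
  rw [ofPoly_aeval, h1, h0]
  exact congrArg (fun f => f P) h

theorem TotLE.mapCoeff {d : ℤ} {A : XInvSeries K} (h : TotLE d A) (a b : K) :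
    TotLE d (mapCoeff (affineSubst a b) A) := fun k j hk => by
  rw [xCoeff_mapCoeff]
  by_cases h0 : xCoeff A k = 0
  · rw [h0, map_zero, Polynomial.coeff_zero]
  · have h1 : k + (xCoeff A k).natDegree ≤ d := by
      by_contra hlt
      exact Polynomial.leadingCoeff_ne_zero.mpr h0 (h k _ (by omega))
    have h2 : (affineSubst a b (xCoeff A k)).natDegree ≤ (xCoeff A k).natDegree * 1 :=
      Polynomial.natDegree_comp_le.trans (Nat.mul_le_mul_left _ Polynomial.natDegree_linear_le)
    exact Polynomial.coeff_eq_zero_of_natDegree_lt (by omega)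

theorem exists_expansion_of_not_jacobianConjecture [CharZero K] (h : ¬ JacobianConjecture K) :
    ∃ (P Q : MvPolynomial (Fin 2) K) (C F : XInvSeries K) (n m : ℕ) (lam : ℕ → K),
      ¬ n ∣ m ∧ ¬ m ∣ n ∧ lam 0 = 1 ∧ C.IsNormalized ∧
      C.deg = (((1 : ℤ) : WithTop ℤ) : WithBot (WithTop ℤ)) ∧
      F.deg = (((2 - (n : ℤ) : ℤ) : WithTop ℤ) : WithBot (WithTop ℤ)) ∧
      F.leadingTermX = xMonomial (1 - (n : ℤ)) Polynomial.X ∧ C ^ n = ofPoly P ∧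
      ofPoly Q = (∑ i ∈ Finset.range (m + n - 2 + 1),
        const (lam i) * C.intPow ((m : ℤ) - (i : ℤ))) + F := by
  obtain ⟨P, Q, n, m, hn, hm, hcex, hP, hQ, hP1, hQ1, hmin⟩ := exists_minimal_counterexample h
  have hnm := not_dvd_of_minimal hn hm hcex hP hQ hP1 hQ1 hmin
  have hmn := not_dvd_of_minimal hm hn hcex.swap hQ hP hQ1 hP1 fun P' Q' h' => by
    have := hmin _ _ h'.swap
    omega
  obtain ⟨a, b, hab⟩ := exists_tschirnhaus hn hP hP1
  set f : MvPolynomial (Fin 2) K := X 0 - MvPolynomial.C a * X 1 - MvPolynomial.C b with hf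
  have hJ := hcex.1.translate a b
  rw [← hf] at hJ
  have hfm : MonicX (1 : ℕ) (ofPoly f) ∧ TotLE 1 (ofPoly f) := by
    have hx := monicX_xMonomial (K := K) 1
    have hrest : XLE 0 (const a * xMonomial 0 Polynomial.X) := XLE.const_mul _ fun k hk => by
      rw [xCoeff_xMonomial, if_neg (by omega)]
    rw [hf, map_sub, map_sub, map_mul, ofPoly_C, ofPoly_C, ofPoly_X0, ofPoly_X1]
    refine ⟨⟨(hx.1.sub (hrest.mono (by simp))).sub ((XLE.const b).mono (by simp)), ?_⟩,
      ((totLE_xMonomial (by simp)).sub ((totLE_xMonomial (by simp)).const_mul _)).sub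
      ((TotLE.const b).mono (by simp))⟩
    rw [Nat.cast_one, xCoeff_sub, xCoeff_sub, hx.2, hrest 1 one_pos, XLE.const b 1 one_pos,
      sub_zero, sub_zero]
  have hY : TotLE 1 (ofPoly (X 1 : MvPolynomial (Fin 2) K)) := by
    rw [ofPoly_X1]
    exact totLE_xMonomial (by simp)
  have hY1 : XLE (1 : ℕ) (ofPoly (X 1 : MvPolynomial (Fin 2) K)) ∧
      xCoeff (ofPoly (X 1 : MvPolynomial (Fin 2) K)) (1 : ℕ) = Polynomial.C 0 := by
    rw [ofPoly_X1]
    refine ⟨fun k hk => ?_, ?_⟩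
    · rw [xCoeff_xMonomial, if_neg (by push_cast at hk; omega)]
    · rw [xCoeff_xMonomial, if_neg (by simp), map_zero]
  have hX1 : MonicX (1 : ℕ) (ofPoly (X 0 : MvPolynomial (Fin 2) K)) := by
    rw [ofPoly_X0]
    exact monicX_xMonomial 1
  -- The translation preserves the monic shape in `x`, so the expansion can be redone for the new
  -- pair; `n` and `m`, and with them the non-divisibility, stay the same.
  have hsubst : ∀ (G : MvPolynomial (Fin 2) K) (d : ℕ), TotLE d (ofPoly G) →
      TotLE d (ofPoly (aeval ![f, X 1] G)) ∧
      xCoeff (ofPoly (aeval ![f, X 1] G)) d = xCoeff (ofPoly G) d := fun G d hG => by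
    have hG' := (totLE_ofPoly_iff G d).mp hG
    have hW := xle_weightEval_of_totalDegree_le hG'
    refine ⟨?_, ?_⟩
    · rw [ofPoly_aeval]
      exact hfm.2.evalAt hY hG'
    · have h1 := hX1.xCoeff_evalAt one_pos hY1.1 hY1.2 hW
      rw [ofPoly_X0, ofPoly_X1, ← ofPoly_eq_evalAt] at h1
      rw [ofPoly_aeval, hfm.1.xCoeff_evalAt one_pos hY1.1 hY1.2 hW, h1]
  set P' := aeval ![f, X 1] P
  set Q' := aeval ![f, X 1] Q
  have hP1' : xCoeff (ofPoly P') n = 1 := (hsubst P n hP).2.trans hP1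
  have hQ1' : xCoeff (ofPoly Q') m = 1 := (hsubst Q m hQ).2.trans hQ1
  obtain ⟨u, lam, F, c, hc, hu, hu1, hun, hlam, hF, hF1, hF2, hexp⟩ :=
    exists_root_expansion hn hm hJ (hsubst P n hP).1 (hsubst Q m hQ).1 hP1' hQ1'
  -- The coefficient of `x^(n-1)` in `u^n - x^n` is `n` times that of `x^0` in `u`, and the
  -- translation has made it zero.
  have hu0 : xCoeff (u : XInvSeries K) 0 = 0 := by
    have hx := monicX_xMonomial (K := K) 1
    have hxle : XLE 0 ((u : XInvSeries K) - xMonomial 1 1) := fun k hk => by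
      rcases (show k = 1 ∨ 1 < k by omega) with rfl | hk1
      · rw [xCoeff_sub, hu.2, hx.2, sub_self]
      · rw [xCoeff_sub, hu.1 k hk1, hx.1 k hk1, sub_self]
    have h1 := (hu.pow_sub_pow hx hxle n).2
    rw [hun, hab _ (by omega), xCoeff_sub, xCoeff_xMonomial, if_neg (by omega), sub_zero] at h1
    exact (mul_eq_zero.mp h1.symm).resolve_left (Nat.cast_ne_zero.mpr hn)
  obtain ⟨τ, hτ⟩ : ∃ τ : K, xCoeff F (1 - n) = Polynomial.C c * Polynomial.X + Polynomial.C τ := by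
    have h1 : Polynomial.derivative (xCoeff F (1 - n) - Polynomial.C c * Polynomial.X) = 0 := by
      rw [map_sub, hF2, Polynomial.derivative_C_mul, Polynomial.derivative_X, mul_one, sub_self]
    exact ⟨_, (sub_eq_iff_eq_add'.mp (Polynomial.eq_C_of_derivative_eq_zero h1))⟩
  -- The substitution `y ↦ (y - τ)/c` turns the leading coefficient `cy + τ` of `F` into `y`. Being
  -- a ring homomorphism that fixes `K` and `x`, it carries the whole expansion along.
  set M : XInvSeries K →+* XInvSeries K := mapCoeff (affineSubst c⁻¹ (-(c⁻¹ * τ))) with hM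
  have hMu : ((Units.map (M : XInvSeries K →* XInvSeries K) u : (XInvSeries K)ˣ) :
      XInvSeries K) = M u := rfl
  have hMF : xCoeff (M F) (1 - n) = Polynomial.X := by
    rw [hM, xCoeff_mapCoeff, hτ, map_add, map_mul, affineSubst_C, affineSubst_C, affineSubst_X,
      mul_add, ← mul_assoc, ← map_mul, ← map_mul, mul_inv_cancel₀ hc, map_one, one_mul, add_assoc,
      ← map_add, mul_neg, mul_inv_cancel_left₀ hc, neg_add_cancel, map_zero, add_zero]
  have hnorm : (M u).IsNormalized := by
    refine ⟨?_, ?_, fun k hk => ?_⟩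
    · rw [hM, xCoeff_mapCoeff, hu.2, map_one]
    · rw [hM, xCoeff_mapCoeff, hu0, map_zero]
    · rw [hM, xCoeff_mapCoeff, hu.1 k hk, map_zero]
  set g : MvPolynomial (Fin 2) K := MvPolynomial.C c⁻¹ * X 1 + MvPolynomial.C (-(c⁻¹ * τ)) with hg
  refine ⟨aeval ![X 0, g] P', aeval ![X 0, g] Q', M u, M F, n, m, lam, hnm, hmn, hlam, hnorm, ?_, ?_, ?_, ?_, ?_⟩
  · refine (hu1.mapCoeff _ _).deg_eq (k := 1) (j := 0) ?_ (by simp)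
    rw [hnorm.1]
    simp
  -- The leading monomial `x^(1-n) y` attains the bound `2 - n`.
  · refine (hF1.mapCoeff _ _).deg_eq (k := 1 - n) (j := 1) ?_ (by push_cast; ring)
    rw [hMF]
    simp
  · refine (leadingTermX_eq_iff Polynomial.X_ne_zero).mpr ⟨fun k hk => ?_, hMF⟩
    rw [hM, xCoeff_mapCoeff, hF k hk, map_zero]
  · rw [← map_pow, hun, hM, hg, mapCoeff_ofPoly]
  · rw [hg, ← mapCoeff_ofPoly, ← hM, hexp, map_add, map_sum]
    congr 1
    refine Finset.sum_congr rfl fun i _ => ?_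
    rw [map_mul, hM, mapCoeff_const, ← hM, ← hMu, intPow_unit, ← map_zpow]
    rfl

end XInvSeries

theorem mainTheorem1 (K : Type*) [Field K] [CharZero K] :
    (¬ JacobianConjecture K ↔
      ∃ (P Q : MvPolynomial (Fin 2) K) (C F : XInvSeries K) (n m : ℕ) (lam : ℕ → K),
        ¬ n ∣ m ∧ ¬ m ∣ n ∧ lam 0 = 1 ∧
        C.IsNormalized ∧
        C.deg = (((1 : ℤ) : WithTop ℤ) : WithBot (WithTop ℤ)) ∧
        F.deg = (((2 - (n : ℤ) : ℤ) : WithTop ℤ) : WithBot (WithTop ℤ)) ∧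
        F.leadingTermX = XInvSeries.xMonomial (1 - (n : ℤ)) Polynomial.X ∧
        C ^ n = XInvSeries.ofPoly P ∧
        XInvSeries.ofPoly Q =
          (∑ i ∈ Finset.range (m + n - 2 + 1), XInvSeries.const (lam i) * C.intPow ((m : ℤ) - (i : ℤ))) + F) ∧
    ∀ (P Q : MvPolynomial (Fin 2) K) (C F : XInvSeries K) (n m : ℕ) (lam : ℕ → K),
        ¬ n ∣ m → ¬ m ∣ n → lam 0 = 1 →
        C.IsNormalized →
        C.deg = (((1 : ℤ) : WithTop ℤ) : WithBot (WithTop ℤ)) →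
        F.deg = (((2 - (n : ℤ) : ℤ) : WithTop ℤ) : WithBot (WithTop ℤ)) →
        F.leadingTermX = XInvSeries.xMonomial (1 - (n : ℤ)) Polynomial.X →
        C ^ n = XInvSeries.ofPoly P →
        XInvSeries.ofPoly Q =
          (∑ i ∈ Finset.range (m + n - 2 + 1), XInvSeries.const (lam i) * C.intPow ((m : ℤ) - (i : ℤ))) + F →
        IsJacobianCounterexample P Q := by
  refine ⟨⟨XInvSeries.exists_expansion_of_not_jacobianConjecture, ?_⟩, ?_⟩
  · rintro ⟨P, Q, C, F, n, m, lam, hnm, hmn, hlam, hC, -, -, hF, hP, hQ⟩ hJC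
    have h := XInvSeries.isJacobianCounterexample_of_expansion hnm hmn hlam hC hF hP hQ
    exact h.2 (hJC P Q h.1)
  · intro P Q C F n m lam hnm hmn hlam hC _ _ hF hP hQ
    exact XInvSeries.isJacobianCounterexample_of_expansion hnm hmn hlam hC hF hP hQ
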